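/- Let $N\in\mathbb{N}$, $t_c>0$, $\tau>0$, and let $\mathcal{H}=\ell^2(\mathbb{N})\oplus\ell^2(\mathbb{N})\oplus\mathbb{C}^N$ (two semi-infinite leads, $\mathbb{N}=\{0,1,2,\dots\}$, and a finite sample). On each lead $j\in\{1,2\}$ let $h_j$ be the Dirichlet Laplacian $\Delta_D$ on $\ell^2(\mathbb{N})$, $$(\Delta_D\psi)(0)=t_c\,\psi(1),\qquad (\Delta_D\psi)(n)=t_c\big(\psi(n+1)+\psi(n-1)\big)\quad (n\ge 1).$$ Let $h_s$ be a self-adjoint operator on $\mathbb{C}^N$, let $S_1,S_2\in\mathbb{C}^N$, let $L_j$ be a compactly (i.e. finitely) supported vector in the $j$-th lead, and let $$H=h_1+h_2+h_s+\tau\sum_{j=1}^2\big(|S_j\rangle\langle L_j|+|L_j\rangle\langle S_j|\big)$$ be the coupled Hamiltonian on $\mathcal{H}$. For $E\in\mathbb{R}$ define the operator on $\mathbb{C}^N$ $$S(E)=h_s-E-\tau^2\sum_{j=1}^2\langle L_j,(h_j-E-\mathrm{i}0_+)^{-1}L_j\rangle\,|S_j\rangle\langle S_j|,$$ where $\langle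 L_j,(h_j-E-\mathrm{i}0_+)^{-1}L_j\rangle:=\lim_{\varepsilon\downarrow 0}\langle L_j,(h_j-E-\mathrm{i}\varepsilon)^{-1}L_j\rangle$. Assume that $S(E)$ is invertible for every $E\in\mathbb{R}$. Then for all compactly supported $f,g\in\mathcal{H}$ (that is, with finitely supported components in both leads) there exists a constant $C_{f,g}$ such that $$|\langle f,\mathrm{e}^{\mathrm{i}tH}g\rangle|\le C_{f,g}\,t^{-3/2}\qquad\text{for all } t\ge 1.$$ Consequently, for all compactly supported $f,g\in\mathcal{H}$, $$\int_{\mathbb{R}}|\langle f,\mathrm{e}^{\mathrm{i}tH}g\rangle|\,\mathrm{d}t<\infty .$$ -/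

import Mathlib

open scoped ENNReal Topology

noncomputable section

/-- The Hilbert space `ℓ²(ℕ)` of a single semi-infinite lead. -/
abbrev Lead : Type := lp (fun _ : ℕ => ℂ) 2

/-- The Hilbert space `ℂ^N` of the small sample. -/
abbrev Sample (N : ℕ) : Type := EuclideanSpace ℂ (Fin N)

/-- The one-particle Hilbert space `ℓ²(ℕ) ⊕ ℓ²(ℕ) ⊕ ℂ^N` of the system
(two leads, indexed by `Fin 2`, and the sample). -/
abbrev System (N : ℕ) : Type :=
  WithLp 2 (PiLp 2 (fun _ : Fin 2 => Lead) × Sample N)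

namespace Lead

lemma summable_sq (ψ : Lead) : Summable fun n => ‖ψ n‖ ^ (2 : ℝ≥0∞).toReal :=
  (lp.memℓp ψ).summable (by norm_num)

/-- The sequence `0, ψ(0), ψ(1), …`. -/
def shiftRightFun (ψ : ℕ → ℂ) : ℕ → ℂ
  | 0 => 0
  | n + 1 => ψ n

lemma summable_shiftRightFun (ψ : Lead) :
    Summable fun n => ‖shiftRightFun ψ n‖ ^ (2 : ℝ≥0∞).toReal := by
  rw [← summable_nat_add_iff 1]
  exact summable_sq ψ

/-- The left shift `(L ψ)(n) = ψ(n + 1)`. -/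
def shiftLeft : Lead →L[ℂ] Lead :=
  LinearMap.mkContinuous
    { toFun := fun ψ => ⟨fun n => ψ (n + 1),
        memℓp_gen ((summable_nat_add_iff 1).2 (summable_sq ψ))⟩
      map_add' := fun _ _ => rfl
      map_smul' := fun _ _ => rfl }
    1 fun ψ => by
      rw [one_mul]
      refine lp.norm_le_of_tsum_le (by norm_num) (norm_nonneg _) ?_
      rw [lp.norm_rpow_eq_tsum (by norm_num) ψ, (summable_sq ψ).tsum_eq_zero_add]
      exact le_add_of_nonneg_left (by positivity)

/-- The right shift `(R ψ)(0) = 0`, `(R ψ)(n + 1) = ψ(n)`. -/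
def shiftRight : Lead →L[ℂ] Lead :=
  LinearMap.mkContinuous
    { toFun := fun ψ => ⟨shiftRightFun ψ, memℓp_gen (summable_shiftRightFun ψ)⟩
      map_add' := fun φ ψ => by
        apply lp.ext
        funext n
        change shiftRightFun (φ + ψ : Lead) n = shiftRightFun φ n + shiftRightFun ψ n
        cases n <;> simp [shiftRightFun]
      map_smul' := fun c ψ => by
        apply lp.ext
        funext n
        change shiftRightFun (c • ψ : Lead) n = c • shiftRightFun ψ n
        cases n <;> simp [shiftRightFun] }
    1 fun ψ => by
      rw [one_mul]
      refine lp.norm_le_of_tsum_le (by norm_num) (norm_nonneg _) ?_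
      rw [lp.norm_rpow_eq_tsum (by norm_num) ψ]
      refine ((summable_shiftRightFun ψ).tsum_eq_zero_add).trans_le ?_
      simp [shiftRightFun]

/-- The Dirichlet Laplacian on the half-line with hopping constant `tc`. -/
def laplacian (tc : ℝ) : Lead →L[ℂ] Lead := (tc : ℂ) • (shiftLeft + shiftRight)

lemma laplacian_apply_zero (tc : ℝ) (ψ : Lead) : laplacian tc ψ 0 = tc * ψ 1 := by
  change (tc : ℂ) * (ψ (0 + 1) + 0) = _
  simp

lemma laplacian_apply_succ (tc : ℝ) (ψ : Lead) (n : ℕ) :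
    laplacian tc ψ (n + 1) = tc * (ψ (n + 2) + ψ n) := rfl

/-- An element of `ℓ²(ℕ)` is compactly supported if it vanishes off a finite set of sites. -/
def CompactlySupported (ψ : Lead) : Prop := (Function.support fun n : ℕ => ψ n).Finite

/-- The boundary value `⟨φ, (Δ_D - E - i0₊)⁻¹ φ⟩`, i.e. the limit as `ε ↓ 0` of
`⟨φ, (Δ_D - E - iε)⁻¹ φ⟩`.  For `ε > 0` the operator `Δ_D - E - iε` is invertible (`Δ_D` is
self-adjoint), so `Ring.inverse` is its inverse; the limit exists for compactly supported `φ`. -/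
def boundaryResolvent (tc : ℝ) (φ : Lead) (E : ℝ) : ℂ :=
  Filter.limUnder (𝓝[>] (0 : ℝ)) fun ε : ℝ =>
    inner ℂ φ (Ring.inverse
      (laplacian tc - ((E : ℂ) + (ε : ℂ) * Complex.I) • (1 : Lead →L[ℂ] Lead)) φ)

end Lead

namespace System

variable {N : ℕ}

/-- The inclusion of the `j`-th lead in the system. -/
def leadIncl (j : Fin 2) : Lead →L[ℂ] System N :=
  ((WithLp.prodContinuousLinearEquiv 2 ℂ (PiLp 2 fun _ : Fin 2 => Lead) (Sample N)).symm :
      (PiLp 2 fun _ : Fin 2 => Lead) × Sample N →L[ℂ] System N) ∘L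
    ContinuousLinearMap.inl ℂ (PiLp 2 fun _ : Fin 2 => Lead) (Sample N) ∘L
    ((PiLp.continuousLinearEquiv 2 ℂ fun _ : Fin 2 => Lead).symm :
      (Fin 2 → Lead) →L[ℂ] PiLp 2 fun _ : Fin 2 => Lead) ∘L
    ContinuousLinearMap.single ℂ (fun _ : Fin 2 => Lead) j

/-- The inclusion of the sample in the system. -/
def sampleIncl : Sample N →L[ℂ] System N :=
  ((WithLp.prodContinuousLinearEquiv 2 ℂ (PiLp 2 fun _ : Fin 2 => Lead) (Sample N)).symm :
      (PiLp 2 fun _ : Fin 2 => Lead) × Sample N →L[ℂ] System N) ∘L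
    ContinuousLinearMap.inr ℂ (PiLp 2 fun _ : Fin 2 => Lead) (Sample N)

/-- The component in the `j`-th lead. -/
def leadProj (j : Fin 2) : System N →L[ℂ] Lead :=
  PiLp.proj 2 (fun _ : Fin 2 => Lead) j ∘L
    WithLp.fstL 2 ℂ (PiLp 2 fun _ : Fin 2 => Lead) (Sample N)

/-- The component in the sample. -/
def sampleProj : System N →L[ℂ] Sample N :=
  WithLp.sndL 2 ℂ (PiLp 2 fun _ : Fin 2 => Lead) (Sample N)

/-- A vector of the system is compactly supported if both of its lead components are
(the sample has only finitely many sites). -/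
def CompactlySupported (f : System N) : Prop :=
  ∀ j : Fin 2, (leadProj j f).CompactlySupported

/-- The tunneling Hamiltonian `τ ∑ⱼ (|Sⱼ⟩⟨Lⱼ| + |Lⱼ⟩⟨Sⱼ|)`. -/
def tunneling (τ : ℝ) (S : Fin 2 → Sample N) (L : Fin 2 → Lead) : System N →L[ℂ] System N :=
  (τ : ℂ) • ∑ j : Fin 2,
    (InnerProductSpace.rankOne ℂ (sampleIncl (S j)) (leadIncl j (L j)) +
      InnerProductSpace.rankOne ℂ (leadIncl j (L j)) (sampleIncl (S j)))

/-- The coupled one-particle Hamiltonian `H = h₁ + h₂ + h_s + h_τ`, where `h₁`, `h₂` are the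
Dirichlet Laplacians of the two leads. -/
def hamiltonian (tc τ : ℝ) (hs : Sample N →L[ℂ] Sample N) (S : Fin 2 → Sample N)
    (L : Fin 2 → Lead) : System N →L[ℂ] System N :=
  ∑ j : Fin 2, leadIncl j ∘L Lead.laplacian tc ∘L leadProj j +
    sampleIncl ∘L hs ∘L sampleProj + tunneling τ S L

/-- The matrix
`S(E) = h_s - E - τ² ∑ⱼ ⟨Lⱼ, (hⱼ - E - i0₊)⁻¹ Lⱼ⟩ |Sⱼ⟩⟨Sⱼ|`, as an operator on `ℂ^N`. -/
def feshbachMatrix (tc τ : ℝ) (hs : Sample N →L[ℂ] Sample N) (S : Fin 2 → Sample N)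
    (L : Fin 2 → Lead) (E : ℝ) : Sample N →L[ℂ] Sample N :=
  hs - (E : ℂ) • (1 : Sample N →L[ℂ] Sample N) -
    ((τ : ℂ) ^ 2) • ∑ j : Fin 2,
      Lead.boundaryResolvent tc (L j) E • InnerProductSpace.rankOne ℂ (S j) (S j)

/-- The unitary group element `e^{itA}` of a bounded operator `A` on the system, defined by the
exponential series. -/
def evolution (A : System N →L[ℂ] System N) (t : ℝ) : System N →L[ℂ] System N :=
  NormedSpace.exp ((Complex.I * (t : ℂ)) • A)

end System

end

/-! ### The half-line Laplacian in the Joukowski variable -/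

noncomputable section

namespace Lead

open ComplexConjugate

/-! Write the energy as `z = tc (ζ + ζ⁻¹)`. The open unit disc in `ζ` uniformizes the complement of
the band `[-2 tc, 2 tc]`, and the circle double-covers the band. On a lead, with left and right
shifts `L` and `R`, `Δ_D - z = -(tc/ζ) (1 - ζ L) (1 - ζ R)` (`laplacian_sub_factor`). Since `L` is
nilpotent on each compactly supported vector, resolvent matrix elements between such vectors are
polynomials in `ζ`, so they continue across the circle.

Eliminating the leads by Feshbach's formula gives `⟨f, (H - z)⁻¹ g⟩` in terms of these polynomials
and the inverse of `ζ S(z)`. That operator is invertible on the whole closed disc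
(`isUnit_scaledFeshbach`): at nonreal `z` by self-adjointness, at `ζ = 0` because it equals `-tc`,
and elsewhere by the hypothesis on `S(E)`, via an adjoint on the upper semicircle. Hence the matrix
element is holomorphic near the closed disc.

No spectral theorem is used. The algebraic identity `(H - z)⁻¹ H = 1 + z (H - z)⁻¹` survives on the
circle (`resolventElement_hamiltonian`). Cauchy's theorem turns it into integrals for the moments
`⟨f, Hⁿ g⟩` (`iterate_eq_integral`). Summing the exponential series gives `⟨f, e^{itH} g⟩` as an
integral of `e^{2 i tc t cos θ} sin θ u(θ)` with `u` smooth and periodic (`inner_evolution_eq`). The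
factor `sin θ` vanishes at the stationary points: one integration by parts gains `t⁻¹`, and
stationary phase gains another `t^{-1/2}` (`exists_norm_integral_exp_mul_cos_mul_sin_le`). -/

lemma shiftLeft_apply (ψ : Lead) (n : ℕ) : shiftLeft ψ n = ψ (n + 1) := rfl

lemma shiftRight_apply_zero (ψ : Lead) : shiftRight ψ 0 = 0 := rfl

lemma shiftLeft_shiftRight (ψ : Lead) : shiftLeft (shiftRight ψ) = ψ := rfl

lemma norm_shiftLeft_le : ‖shiftLeft‖ ≤ 1 := LinearMap.mkContinuous_norm_le _ zero_le_one _

lemma norm_shiftRight_le : ‖shiftRight‖ ≤ 1 := LinearMap.mkContinuous_norm_le _ zero_le_one _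

lemma inner_shiftRight_right (φ ψ : Lead) :
    inner ℂ φ (shiftRight ψ) = inner ℂ (shiftLeft φ) ψ := by
  rw [lp.inner_eq_tsum, lp.inner_eq_tsum,
    (lp.summable_inner (𝕜 := ℂ) φ (shiftRight ψ)).tsum_eq_zero_add, shiftRight_apply_zero,
    inner_zero_right, zero_add]
  rfl

lemma inner_shiftLeft_right (φ ψ : Lead) :
    inner ℂ φ (shiftLeft ψ) = inner ℂ (shiftRight φ) ψ := by
  rw [← inner_conj_symm, ← inner_shiftRight_right, inner_conj_symm]

lemma inner_laplacian_right (tc : ℝ) (φ ψ : Lead) :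
    inner ℂ φ (laplacian tc ψ) = inner ℂ (laplacian tc φ) ψ := by
  change inner ℂ φ ((tc : ℂ) • (shiftLeft ψ + shiftRight ψ)) =
    inner ℂ ((tc : ℂ) • (shiftLeft φ + shiftRight φ)) ψ
  rw [inner_smul_right, inner_smul_left, inner_add_right, inner_add_left,
    inner_shiftLeft_right, inner_shiftRight_right, Complex.conj_ofReal, add_comm]

lemma shiftLeft_pow_apply (k : ℕ) (ψ : Lead) (n : ℕ) : (shiftLeft ^ k) ψ n = ψ (n + k) := by
  induction k generalizing ψ with
  | zero => rfl
  | succ k ih =>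
    rw [pow_succ]
    change (shiftLeft ^ k) (shiftLeft ψ) n = _
    rw [ih, shiftLeft_apply, add_assoc]

namespace CompactlySupported

variable {φ ψ : Lead}

lemma exists_shiftLeft_pow_eq_zero (h : ψ.CompactlySupported) :
    ∃ K, ∀ k, K ≤ k → (shiftLeft ^ k) ψ = 0 := by
  obtain ⟨B, hB⟩ := h.bddAbove
  refine ⟨B + 1, fun k hk => lp.ext (funext fun n => ?_)⟩
  rw [shiftLeft_pow_apply]
  by_contra hne
  have := hB (show n + k ∈ Function.support fun n : ℕ => ψ n from hne)
  omega

protected lemma add (hφ : φ.CompactlySupported) (hψ : ψ.CompactlySupported) :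
    (φ + ψ).CompactlySupported :=
  (hφ.union hψ).subset (Function.support_add _ _)

protected lemma smul (c : ℂ) (hψ : ψ.CompactlySupported) : (c • ψ).CompactlySupported :=
  hψ.subset (Function.support_const_smul_subset c _)

lemma shiftLeft (hψ : ψ.CompactlySupported) : (Lead.shiftLeft ψ).CompactlySupported :=
  Set.Finite.preimage (f := fun n : ℕ => n + 1) (add_left_injective 1).injOn hψ

lemma shiftRight (hψ : ψ.CompactlySupported) : (Lead.shiftRight ψ).CompactlySupported := by
  refine (hψ.image (fun n : ℕ => n + 1)).subset fun n hn => ?_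
  cases n with
  | zero => exact absurd (shiftRight_apply_zero ψ) hn
  | succ n => exact ⟨n, hn, rfl⟩

lemma laplacian (tc : ℝ) (hψ : ψ.CompactlySupported) :
    (Lead.laplacian tc ψ).CompactlySupported :=
  (hψ.shiftLeft.add hψ.shiftRight).smul _

end CompactlySupported

/-- The Neumann series of `(1 - ζ L)⁻¹ ψ`, where `L` is the left shift. -/
def neumann (ζ : ℂ) (ψ : Lead) : Lead := ∑' k : ℕ, ζ ^ k • (shiftLeft ^ k) ψ

section neumann

variable {φ ψ : Lead}

lemma CompactlySupported.summable_neumann (h : ψ.CompactlySupported) (ζ : ℂ) :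
    Summable fun k : ℕ => ζ ^ k • (Lead.shiftLeft ^ k) ψ := by
  obtain ⟨K, hK⟩ := h.exists_shiftLeft_pow_eq_zero
  refine summable_of_ne_finset_zero (s := Finset.range K) fun k hk => ?_
  rw [hK k (by simpa using hk), smul_zero]

lemma CompactlySupported.exists_neumann_eq_sum (h : ψ.CompactlySupported) :
    ∃ K, ∀ ζ : ℂ, neumann ζ ψ = ∑ k ∈ Finset.range K, ζ ^ k • (Lead.shiftLeft ^ k) ψ := by
  obtain ⟨K, hK⟩ := h.exists_shiftLeft_pow_eq_zero
  refine ⟨K, fun ζ => tsum_eq_sum fun k hk => ?_⟩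
  rw [hK k (by simpa using hk), smul_zero]

lemma neumann_add (hφ : φ.CompactlySupported) (hψ : ψ.CompactlySupported) (ζ : ℂ) :
    neumann ζ (φ + ψ) = neumann ζ φ + neumann ζ ψ := by
  simp only [neumann, map_add, smul_add]
  exact (hφ.summable_neumann ζ).tsum_add (hψ.summable_neumann ζ)

lemma neumann_smul (c ζ : ℂ) (ψ : Lead) : neumann ζ (c • ψ) = c • neumann ζ ψ := by
  simp only [neumann, map_smul, smul_comm _ c]
  exact tsum_const_smul'' c

lemma shiftLeft_neumann (hψ : ψ.CompactlySupported) (ζ : ℂ) :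
    shiftLeft (neumann ζ ψ) = neumann ζ (shiftLeft ψ) := by
  rw [neumann, shiftLeft.map_tsum (hψ.summable_neumann ζ), neumann]
  refine tsum_congr fun k => ?_
  rw [map_smul]
  congr 1
  change (shiftLeft * shiftLeft ^ k) ψ = (shiftLeft ^ k * shiftLeft) ψ
  rw [(Commute.pow_self shiftLeft k).eq]

lemma neumann_eq_add (hψ : ψ.CompactlySupported) (ζ : ℂ) :
    neumann ζ ψ = ψ + ζ • neumann ζ (shiftLeft ψ) := by
  rw [neumann, (hψ.summable_neumann ζ).tsum_eq_zero_add, neumann, ← tsum_const_smul'' ζ]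
  congr 1
  · simp
  · refine tsum_congr fun k => ?_
    rw [smul_smul, pow_succ' ζ, pow_succ shiftLeft]
    rfl

/-- Only `L R = 1` holds, not `R L = 1`, so the order of the factors matters: `(1 - ζ L)(1 - ζ R) =
1 + ζ² - ζ (L + R)`. -/
lemma laplacian_sub_factor (tc : ℝ) {ζ : ℂ} (hζ : ζ ≠ 0) (ψ : Lead) :
    laplacian tc ψ - ((tc : ℂ) * (ζ + ζ⁻¹)) • ψ =
      -((tc : ℂ) / ζ) • ((ψ - ζ • shiftRight ψ) - ζ • shiftLeft (ψ - ζ • shiftRight ψ)) := by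
  rw [map_sub, map_smul, shiftLeft_shiftRight]
  change (tc : ℂ) • (shiftLeft ψ + shiftRight ψ) - _ = _
  match_scalars <;> field_simp
  ring

/-- The sesquilinear form of `(Δ_D - z)⁻¹`, `z = tc (ζ + ζ⁻¹)`, on compactly supported vectors,
continued to all `ζ`. -/
def resolventForm (tc : ℝ) (φ ψ : Lead) (ζ : ℂ) : ℂ :=
  -(ζ / tc) * inner ℂ (neumann (conj ζ) φ) (neumann ζ ψ)

lemma resolventForm_add (tc : ℝ) (φ : Lead) {ψ χ : Lead} (hψ : ψ.CompactlySupported)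
    (hχ : χ.CompactlySupported) (ζ : ℂ) :
    resolventForm tc φ (ψ + χ) ζ = resolventForm tc φ ψ ζ + resolventForm tc φ χ ζ := by
  simp only [resolventForm, neumann_add hψ hχ, inner_add_right, mul_add]

lemma resolventForm_smul (tc : ℝ) (φ ψ : Lead) (c ζ : ℂ) :
    resolventForm tc φ (c • ψ) ζ = c * resolventForm tc φ ψ ζ := by
  simp only [resolventForm, neumann_smul, inner_smul_right]
  ring

lemma resolventForm_conj (tc : ℝ) (φ : Lead) (ζ : ℂ) :
    resolventForm tc φ φ (conj ζ) = conj (resolventForm tc φ φ ζ) := by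
  simp [resolventForm]

/-- The conjugate on the left argument cancels the antilinearity of the inner product, and both
Neumann series are finite, so the form is a polynomial in `ζ`. -/
lemma contDiff_resolventForm (tc : ℝ) (hφ : φ.CompactlySupported) (hψ : ψ.CompactlySupported)
    {n : WithTop ℕ∞} : ContDiff ℂ n (resolventForm tc φ ψ) := by
  obtain ⟨K, hK⟩ := hφ.exists_neumann_eq_sum
  obtain ⟨M, hM⟩ := hψ.exists_neumann_eq_sum
  have : resolventForm tc φ ψ = fun ζ => -(ζ / tc) * ∑ k ∈ Finset.range K,
      ζ ^ k * ∑ m ∈ Finset.range M, ζ ^ m *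
        inner ℂ ((shiftLeft ^ k) φ) ((shiftLeft ^ m) ψ) := by
    funext ζ
    simp only [resolventForm, hK, hM, sum_inner, inner_sum, inner_smul_left, inner_smul_right,
      map_pow, Complex.conj_conj, Finset.mul_sum]
    rw [Finset.sum_comm]
    exact Finset.sum_congr rfl fun k _ => Finset.sum_congr rfl fun m _ => by ring
  rw [this]
  fun_prop

/-- Purely algebraic from the factorization, so it also holds for `‖ζ‖ = 1`, where no bounded
resolvent is at hand. The factor `1 - ζ L` cancels the right Neumann series; `1 - ζ R`, moved to the
left argument as the adjoint of `1 - conj ζ L`, cancels the other. -/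
lemma resolventForm_laplacian {tc : ℝ} (htc : tc ≠ 0) (hφ : φ.CompactlySupported)
    (hψ : ψ.CompactlySupported) {ζ : ℂ} (hζ : ζ ≠ 0) :
    resolventForm tc φ (laplacian tc ψ) ζ =
      (tc : ℂ) * (ζ + ζ⁻¹) * resolventForm tc φ ψ ζ + inner ℂ φ ψ := by
  set χ := ψ - ζ • shiftRight ψ with hχdef
  have hneg : ∀ {θ : Lead} (c : ℂ), θ.CompactlySupported → (-(c • θ)).CompactlySupported :=
    fun c h => by rw [← neg_smul]; exact h.smul _
  have hχ : χ.CompactlySupported := by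
    rw [hχdef, sub_eq_add_neg]; exact hψ.add (hneg _ hψ.shiftRight)
  have hlap : laplacian tc ψ = ((tc : ℂ) * (ζ + ζ⁻¹)) • ψ +
      -((tc : ℂ) / ζ) • (χ + (-ζ) • shiftLeft χ) := by
    rw [neg_smul ζ, ← sub_eq_add_neg, ← laplacian_sub_factor tc hζ, add_sub_cancel]
  have hn : neumann ζ (χ + (-ζ) • shiftLeft χ) = χ := by
    rw [neumann_add hχ (hχ.shiftLeft.smul _), neumann_smul, neumann_eq_add hχ, neg_smul,
      add_neg_cancel_right]
  have hin : inner ℂ (neumann (conj ζ) φ) χ = inner ℂ φ ψ := by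
    rw [hχdef, inner_sub_right, inner_smul_right, inner_shiftRight_right, shiftLeft_neumann hφ,
      neumann_eq_add hφ, inner_add_left, inner_smul_left, Complex.conj_conj, add_sub_cancel_right]
  rw [hlap, resolventForm_add tc φ (hψ.smul _) ((hχ.add (hχ.shiftLeft.smul _)).smul _),
    resolventForm_smul, resolventForm_smul]
  congr 1
  rw [resolventForm, hn, hin]
  have : (tc : ℂ) ≠ 0 := by exact_mod_cast htc
  field_simp

/-! ### The lead resolvent inside the disc and its boundary values -/

lemma isUnit_one_sub_smul_of_norm_lt_one {A : Lead →L[ℂ] Lead} (hA : ‖A‖ ≤ 1) {ζ : ℂ}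
    (hζ : ‖ζ‖ < 1) : IsUnit (1 - ζ • A) := by
  refine isUnit_one_sub_of_norm_lt_one ?_
  rw [norm_smul]
  exact (mul_le_of_le_one_right (norm_nonneg _) hA).trans_lt hζ

lemma isUnit_laplacian_sub {tc : ℝ} (htc : tc ≠ 0) {ζ : ℂ} (hζ0 : ζ ≠ 0) (hζ : ‖ζ‖ < 1) :
    IsUnit (laplacian tc - ((tc : ℂ) * (ζ + ζ⁻¹)) • (1 : Lead →L[ℂ] Lead)) := by
  have hc : -((tc : ℂ) / ζ) ≠ 0 := by simpa [hζ0] using htc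
  have h : laplacian tc - ((tc : ℂ) * (ζ + ζ⁻¹)) • (1 : Lead →L[ℂ] Lead) =
      Units.mk0 _ hc • ((1 - ζ • shiftLeft) * (1 - ζ • shiftRight)) :=
    ContinuousLinearMap.ext fun ψ => laplacian_sub_factor tc hζ0 ψ
  rw [h]
  exact ((isUnit_one_sub_smul_of_norm_lt_one norm_shiftLeft_le hζ).mul
    (isUnit_one_sub_smul_of_norm_lt_one norm_shiftRight_le hζ)).smul _

/-- If `ζ` lies in the punctured unit disc, `resolventForm` is given by the resolvent. -/
lemma inner_eq_resolventForm {tc : ℝ} (htc : tc ≠ 0) (hφ : φ.CompactlySupported)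
    {ζ : ℂ} (hζ0 : ζ ≠ 0) (hψ : ψ.CompactlySupported) {η : Lead}
    (hη : laplacian tc η - ((tc : ℂ) * (ζ + ζ⁻¹)) • η = ψ) (hζ : ‖ζ‖ < 1) :
    inner ℂ φ η = resolventForm tc φ ψ ζ := by
  set χ := η - ζ • shiftRight η with hχdef
  have htc' : (tc : ℂ) ≠ 0 := by exact_mod_cast htc
  have h1 : (1 - ζ • shiftLeft) (neumann ζ ψ) = ψ := by
    change neumann ζ ψ - ζ • shiftLeft (neumann ζ ψ) = ψ
    rw [shiftLeft_neumann hψ, sub_eq_iff_eq_add, ← neumann_eq_add hψ]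
  have h2 : (1 - ζ • shiftLeft) (-((tc : ℂ) / ζ) • χ) = ψ := by
    rw [map_smul, ← hη, laplacian_sub_factor tc hζ0]
    rfl
  obtain ⟨u, hu⟩ := isUnit_one_sub_smul_of_norm_lt_one norm_shiftLeft_le hζ
  have h3 : neumann ζ ψ = -((tc : ℂ) / ζ) • χ := by
    have key : ∀ x, (↑u⁻¹ : Lead →L[ℂ] Lead) ((1 - ζ • shiftLeft) x) = x := fun x => by
      rw [← hu]
      exact congrArg (fun A : Lead →L[ℂ] Lead => A x) u.inv_mul
    rw [← key (neumann ζ ψ), h1, ← h2, key]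
  have hin : inner ℂ (neumann (conj ζ) φ) χ = inner ℂ φ η := by
    rw [hχdef, inner_sub_right, inner_smul_right, inner_shiftRight_right, shiftLeft_neumann hφ,
      neumann_eq_add hφ, inner_add_left, inner_smul_left, Complex.conj_conj, add_sub_cancel_right]
  rw [resolventForm, h3, inner_smul_right, hin]
  field_simp

lemma exists_laplacian_sub_eq {tc : ℝ} (htc : tc ≠ 0) {ζ : ℂ} (hζ0 : ζ ≠ 0) (hζ : ‖ζ‖ < 1)
    (ψ : Lead) : ∃ η : Lead, laplacian tc η - ((tc : ℂ) * (ζ + ζ⁻¹)) • η = ψ := by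
  obtain ⟨u, hu⟩ := isUnit_laplacian_sub htc hζ0 hζ
  refine ⟨(↑u⁻¹ : Lead →L[ℂ] Lead) ψ, ?_⟩
  have := congrArg (fun A : Lead →L[ℂ] Lead => A ψ) u.mul_inv
  rw [hu] at this
  exact this

/-- The Herglotz property: for `η = (Δ_D - z)⁻¹ φ`, symmetry of `Δ_D` gives `Im ⟨φ, η⟩ = Im z ‖η‖²`.
-/
lemma exists_im_resolventForm_eq {tc : ℝ} (htc : tc ≠ 0) (hφ : φ.CompactlySupported)
    {ζ : ℂ} (hζ0 : ζ ≠ 0) (hζ : ‖ζ‖ < 1) :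
    ∃ r : ℝ, 0 ≤ r ∧
      (resolventForm tc φ φ ζ).im = ((tc : ℂ) * (ζ + ζ⁻¹)).im * r := by
  obtain ⟨η, hη⟩ := exists_laplacian_sub_eq htc hζ0 hζ φ
  refine ⟨‖η‖ ^ 2, sq_nonneg _, ?_⟩
  rw [← inner_eq_resolventForm htc hφ hζ0 hφ hη hζ]
  have hreal : (inner ℂ (laplacian tc η) η).im = 0 := by
    rw [← Complex.conj_eq_iff_im, inner_conj_symm, inner_laplacian_right]
  nth_rewrite 1 [← hη]
  rw [inner_sub_left, inner_smul_left, inner_self_eq_norm_sq_to_K, Complex.sub_im, hreal]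
  simp [← Complex.ofReal_pow, Complex.mul_im]
  ring

lemma add_inv_im (ζ : ℂ) : (ζ + ζ⁻¹).im = ζ.im * (1 - (Complex.normSq ζ)⁻¹) := by
  rw [Complex.add_im, Complex.inv_im]; ring

lemma add_inv_im_eq_zero_of_norm_eq_one {ζ : ℂ} (h : ‖ζ‖ = 1) : (ζ + ζ⁻¹).im = 0 := by
  rw [add_inv_im, Complex.normSq_eq_norm_sq, h]; simp

/-- Since `ζ + ζ⁻¹` reverses the sign of the imaginary part inside the disc, the boundary value at
`E + i0` belongs to the lower semicircle. -/
lemma im_add_inv_pos_iff {ζ : ℂ} (hζ0 : ζ ≠ 0) (hζ : ‖ζ‖ < 1) : 0 < (ζ + ζ⁻¹).im ↔ ζ.im < 0 := by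
  have h : 1 - (Complex.normSq ζ)⁻¹ < 0 := by
    rw [sub_neg, Complex.normSq_eq_norm_sq]
    exact (one_lt_inv₀ (by positivity)).2 (pow_lt_one₀ (norm_nonneg _) hζ two_ne_zero)
  rw [add_inv_im, mul_pos_iff]
  exact ⟨fun h' => h'.elim (fun h' => absurd h'.2 h.not_gt) And.left, fun h' => Or.inr ⟨h', h⟩⟩

/-- Every nonreal number is of the form `ζ + ζ⁻¹` with `ζ` in the open unit disc. -/
lemma exists_add_inv_eq {w : ℂ} (hw : w.im ≠ 0) : ∃ ζ : ℂ, ζ ≠ 0 ∧ ‖ζ‖ < 1 ∧ ζ + ζ⁻¹ = w := by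
  -- The two roots of `ζ² - w ζ + 1` have product `1`; one lies inside the disc unless both are on
  -- the circle, where their sum is real.
  obtain ⟨s, hs⟩ := IsAlgClosed.exists_pow_nat_eq (w ^ 2 - 4) two_pos
  have hmul : (w + s) / 2 * ((w - s) / 2) = 1 := by linear_combination -hs / 4
  have h0 : (w + s) / 2 ≠ 0 := left_ne_zero_of_mul_eq_one hmul
  have hinv : ((w + s) / 2)⁻¹ = (w - s) / 2 := inv_eq_of_mul_eq_one_right hmul
  have hsum : (w + s) / 2 + ((w + s) / 2)⁻¹ = w := by rw [hinv]; ring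
  rcases lt_trichotomy ‖(w + s) / 2‖ 1 with h | h | h
  · exact ⟨_, h0, h, hsum⟩
  · exact absurd (hsum ▸ add_inv_im_eq_zero_of_norm_eq_one h) hw
  · refine ⟨((w + s) / 2)⁻¹, inv_ne_zero h0, ?_, by rw [inv_inv, add_comm, hsum]⟩
    rw [norm_inv]
    exact inv_lt_one_of_one_lt₀ h

/-- Selects the right one of the two preimages `ζ`, `ζ⁻¹`. If `‖ζ‖ < 1`, then `ζ⁻¹` stays away from
the disc; if `ζ` is on the lower semicircle, then `ζ⁻¹ = conj ζ` is on the upper one, no nearer to a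
point `η` of the lower half-disc. -/
lemma exists_norm_sub_le_mul_norm_sub_inv {ζ : ℂ} (hζ0 : ζ ≠ 0)
    (h : ‖ζ‖ < 1 ∨ ‖ζ‖ = 1 ∧ ζ.im ≤ 0) :
    ∃ c : ℝ, 0 ≤ c ∧ ∀ η : ℂ, ‖η‖ < 1 → η.im < 0 → ‖η - ζ‖ ≤ c * ‖η - ζ⁻¹‖ := by
  rcases h with h | ⟨h, him⟩
  · have hd : 0 < ‖ζ‖⁻¹ - 1 := sub_pos.2 ((one_lt_inv₀ (norm_pos_iff.2 hζ0)).2 h)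
    refine ⟨2 / (‖ζ‖⁻¹ - 1), by positivity, fun η hη _ => ?_⟩
    have h1 : ‖ζ‖⁻¹ - 1 ≤ ‖η - ζ⁻¹‖ := by
      have := norm_sub_norm_le ζ⁻¹ η
      rw [norm_inv, norm_sub_rev] at this
      linarith
    have h2 : ‖η - ζ‖ ≤ 2 := (norm_sub_le _ _).trans (by linarith)
    rw [div_mul_eq_mul_div, le_div_iff₀ hd]
    nlinarith [norm_nonneg (η - ζ)]
  · refine ⟨1, zero_le_one, fun η _ hη => ?_⟩
    have hinv : ζ⁻¹ = conj ζ := by rw [Complex.inv_def, Complex.normSq_eq_norm_sq, h]; simp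
    rw [one_mul, hinv]
    refine (sq_le_sq₀ (norm_nonneg _) (norm_nonneg _)).1 ?_
    rw [← Complex.normSq_eq_norm_sq, ← Complex.normSq_eq_norm_sq, Complex.normSq_apply,
      Complex.normSq_apply]
    simp only [Complex.sub_re, Complex.sub_im, Complex.conj_re, Complex.conj_im]
    nlinarith [mul_nonneg_of_nonpos_of_nonpos hη.le him]

/-- Let `Z ε` be the preimage in the disc of `E + iε`. The product `(Z ε - ζ)(Z ε - ζ⁻¹)` is `O(ε)`
and the second factor dominates the first, so `Z ε → ζ` at rate `√ε`. This includes the band edges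
`ζ = ±1`, where the two preimages coincide. Continuity of the polynomial form then gives the limit.
-/
lemma boundaryResolvent_eq {tc : ℝ} (htc : 0 < tc) (hφ : φ.CompactlySupported) {ζ : ℂ}
    (hζ0 : ζ ≠ 0) (h : ‖ζ‖ < 1 ∨ ‖ζ‖ = 1 ∧ ζ.im ≤ 0) {E : ℝ}
    (hE : (tc : ℂ) * (ζ + ζ⁻¹) = E) : boundaryResolvent tc φ E = resolventForm tc φ φ ζ := by
  have htc' : (tc : ℂ) ≠ 0 := by exact_mod_cast htc.ne'
  have him : ∀ ε : ℝ, (((E : ℂ) + ε * Complex.I) / tc).im = ε / tc := fun ε => by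
    simp [Complex.div_ofReal_im]
  have hex : ∀ ε : ℝ, 0 < ε → ∃ η : ℂ, η ≠ 0 ∧ ‖η‖ < 1 ∧
      η + η⁻¹ = ((E : ℂ) + ε * Complex.I) / tc := fun ε hε => exists_add_inv_eq (by
    rw [him]; positivity)
  choose! Z hZ0 hZ1 hZ using hex
  obtain ⟨c, hc0, hc⟩ := exists_norm_sub_le_mul_norm_sub_inv hζ0 h
  have hbound : ∀ ε : ℝ, 0 < ε → ‖Z ε - ζ‖ ≤ √(c * (ε / tc)) := fun ε hε => by
    have hneg : (Z ε).im < 0 := by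
      rw [← im_add_inv_pos_iff (hZ0 ε hε) (hZ1 ε hε), hZ ε hε, him]; positivity
    have hprod : (Z ε - ζ) * (Z ε - ζ⁻¹) = Z ε * (ε / tc * Complex.I) := by
      have h1 : Z ε * (Z ε)⁻¹ = 1 := mul_inv_cancel₀ (hZ0 ε hε)
      have h2 : ζ * ζ⁻¹ = 1 := mul_inv_cancel₀ hζ0
      have h3 : ζ + ζ⁻¹ = E / tc := by rw [eq_div_iff htc', mul_comm, hE]
      have h4 := hZ ε hε
      linear_combination Z ε * h4 - Z ε * h3 - h1 + h2
    have hprod' : ‖Z ε - ζ‖ * ‖Z ε - ζ⁻¹‖ ≤ ε / tc := by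
      rw [← norm_mul, hprod, norm_mul, norm_mul, Complex.norm_I, mul_one, ← Complex.ofReal_div,
        Complex.norm_real, Real.norm_of_nonneg (by positivity)]
      exact mul_le_of_le_one_left (by positivity) (hZ1 ε hε).le
    refine Real.le_sqrt_of_sq_le ?_
    calc ‖Z ε - ζ‖ ^ 2 ≤ ‖Z ε - ζ‖ * (c * ‖Z ε - ζ⁻¹‖) := by
          rw [pow_two]; gcongr; exact hc _ (hZ1 ε hε) hneg
      _ = c * (‖Z ε - ζ‖ * ‖Z ε - ζ⁻¹‖) := by ring
      _ ≤ _ := by gcongr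
  have hlim : Filter.Tendsto Z (𝓝[>] 0) (𝓝 ζ) := by
    rw [tendsto_iff_norm_sub_tendsto_zero]
    have h0 : Filter.Tendsto (fun ε : ℝ => √(c * (ε / tc))) (𝓝[>] 0) (𝓝 0) := by
      have : Continuous fun ε : ℝ => √(c * (ε / tc)) := by fun_prop
      simpa using (this.tendsto 0).mono_left nhdsWithin_le_nhds
    refine squeeze_zero' (Filter.Eventually.of_forall fun _ => norm_nonneg _) ?_ h0
    filter_upwards [self_mem_nhdsWithin] with ε hε using hbound ε hε
  refine Filter.Tendsto.limUnder_eq ?_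
  have hcont := (contDiff_resolventForm (n := 0) tc hφ hφ).continuous
  refine ((hcont.tendsto ζ).comp hlim).congr' ?_
  filter_upwards [self_mem_nhdsWithin] with ε hε
  have hz : (E : ℂ) + ε * Complex.I = tc * (Z ε + (Z ε)⁻¹) := by
    rw [hZ ε hε, mul_div_cancel₀ _ htc']
  rw [hz]
  have hu := isUnit_laplacian_sub htc.ne' (hZ0 ε hε) (hZ1 ε hε)
  have hinv := congrArg (fun A : Lead →L[ℂ] Lead => A φ) (Ring.mul_inverse_cancel _ hu)
  exact (inner_eq_resolventForm htc.ne' hφ (hZ0 ε hε) hφ hinv (hZ1 ε hε)).symm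

end neumann

end Lead

end

/-! ### Oscillatory integrals with phase `cos θ` -/

section

open MeasureTheory intervalIntegral

/-- By `π`-periodicity it suffices to integrate over `[-π/2, π/2]`, where Jordan's inequality `|sin
θ| ≥ 2|θ|/π` bounds the integrand by that of an arctangent. -/
lemma integral_inv_sin_sq_add_sq_le {δ : ℝ} (hδ : 0 < δ) :
    ∫ θ in (0 : ℝ)..2 * Real.pi, (Real.sin θ ^ 2 + δ ^ 2)⁻¹ ≤ Real.pi ^ 2 / δ := by
  have hpi := Real.pi_pos
  have hpos : ∀ θ : ℝ, 0 < Real.sin θ ^ 2 + δ ^ 2 := fun θ => by positivity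
  have hcont : Continuous fun θ : ℝ => (Real.sin θ ^ 2 + δ ^ 2)⁻¹ :=
    Continuous.inv₀ (by fun_prop) fun θ => (hpos θ).ne'
  have hper : Function.Periodic (fun θ : ℝ => (Real.sin θ ^ 2 + δ ^ 2)⁻¹) Real.pi := fun θ => by
    simp [Real.sin_add_pi]
  have hhalf : ∀ a : ℝ, ∫ θ in a..a + Real.pi, (Real.sin θ ^ 2 + δ ^ 2)⁻¹ =
      ∫ θ in -(Real.pi / 2)..Real.pi / 2, (Real.sin θ ^ 2 + δ ^ 2)⁻¹ := fun a => by
    rw [hper.intervalIntegral_add_eq a (-(Real.pi / 2))]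
    congr 1
    ring
  have hsplit : ∫ θ in (0 : ℝ)..2 * Real.pi, (Real.sin θ ^ 2 + δ ^ 2)⁻¹ =
      2 * ∫ θ in -(Real.pi / 2)..Real.pi / 2, (Real.sin θ ^ 2 + δ ^ 2)⁻¹ := by
    rw [← integral_add_adjacent_intervals (hcont.intervalIntegrable 0 (0 + Real.pi))
      (hcont.intervalIntegrable _ _), hhalf 0,
      show 2 * Real.pi = (0 + Real.pi) + Real.pi by ring, hhalf]
    ring
  -- Chosen so that `δ² (1 + (a θ)²) = (2θ/π)² + δ²`.
  set a : ℝ := 2 / (Real.pi * δ) with ha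
  have hapos : 0 < a := by positivity
  have hle : ∫ θ in -(Real.pi / 2)..Real.pi / 2, (Real.sin θ ^ 2 + δ ^ 2)⁻¹ ≤
      ∫ θ in -(Real.pi / 2)..Real.pi / 2, (δ ^ 2)⁻¹ * (1 + (a * θ) ^ 2)⁻¹ := by
    refine integral_mono_on (by linarith) (hcont.intervalIntegrable _ _)
      (Continuous.intervalIntegrable (Continuous.mul continuous_const
        (Continuous.inv₀ (by fun_prop) fun θ => by positivity)) _ _) fun θ hθ => ?_
    rw [← mul_inv]
    refine inv_anti₀ (by positivity) ?_
    have habs : |θ| ≤ Real.pi / 2 := abs_le.2 ⟨hθ.1, hθ.2⟩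
    have hs : 2 / Real.pi * |θ| ≤ |Real.sin θ| := by
      rcases le_total 0 θ with h | h
      · rw [abs_of_nonneg h] at habs ⊢
        exact (Real.mul_le_sin h habs).trans (le_abs_self _)
      · rw [abs_of_nonpos h] at habs ⊢
        have := Real.mul_le_sin (neg_nonneg.2 h) habs
        rw [Real.sin_neg] at this
        exact this.trans (neg_le_abs _)
    have hs2 := pow_le_pow_left₀ (by positivity) hs 2
    rw [mul_pow, sq_abs, sq_abs] at hs2
    have : δ ^ 2 * (1 + (a * θ) ^ 2) = (2 / Real.pi) ^ 2 * θ ^ 2 + δ ^ 2 := by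
      rw [ha]; field_simp; ring
    linarith
  have hval : ∫ θ in -(Real.pi / 2)..Real.pi / 2, (δ ^ 2)⁻¹ * (1 + (a * θ) ^ 2)⁻¹ ≤
      (δ ^ 2)⁻¹ * (a⁻¹ * Real.pi) := by
    rw [intervalIntegral.integral_const_mul,
      intervalIntegral.integral_comp_mul_left (fun x : ℝ => (1 + x ^ 2)⁻¹) hapos.ne',
      integral_inv_one_add_sq, smul_eq_mul]
    have h1 := Real.arctan_lt_pi_div_two (a * (Real.pi / 2))
    have h2 := Real.neg_pi_div_two_lt_arctan (a * -(Real.pi / 2))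
    gcongr
    linarith
  rw [hsplit]
  refine (mul_le_mul_of_nonneg_left (hle.trans hval) zero_le_two).trans (le_of_eq ?_)
  rw [ha]; field_simp

lemma norm_exp_mul_cos (x θ : ℝ) :
    ‖Complex.exp (Complex.I * x * Real.cos θ)‖ = 1 := by
  rw [show Complex.I * x * Real.cos θ = ((x * Real.cos θ : ℝ) : ℂ) * Complex.I by
    push_cast; ring, Complex.norm_exp_ofReal_mul_I]

/-- Integration by parts: `sin θ` is, up to sign, the derivative of the phase, and periodicity
removes the boundary terms. -/
lemma integral_exp_mul_cos_mul_sin {x : ℝ} (hx : x ≠ 0) {w w' : ℝ → ℂ}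
    (hw : ∀ θ, HasDerivAt w (w' θ) θ) (hw' : Continuous w') (hper : w (2 * Real.pi) = w 0) :
    ∫ θ in (0 : ℝ)..2 * Real.pi,
        Complex.exp (Complex.I * x * Real.cos θ) * (Real.sin θ * w θ) =
      (Complex.I * x)⁻¹ *
        ∫ θ in (0 : ℝ)..2 * Real.pi, Complex.exp (Complex.I * x * Real.cos θ) * w' θ := by
  have hwc : Continuous w := continuous_iff_continuousAt.2 fun θ => (hw θ).continuousAt
  have hd : ∀ θ : ℝ, HasDerivAt (fun θ : ℝ => Complex.exp (Complex.I * x * Real.cos θ) * w θ)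
      (-(Complex.I * x) * (Complex.exp (Complex.I * x * Real.cos θ) * (Real.sin θ * w θ)) +
        Complex.exp (Complex.I * x * Real.cos θ) * w' θ) θ := fun θ => by
    have h1 : HasDerivAt (fun θ : ℝ => ((Real.cos θ : ℝ) : ℂ)) ((-Real.sin θ : ℝ) : ℂ) θ :=
      (Real.hasDerivAt_cos θ).ofReal_comp
    have h2 := ((h1.const_mul (Complex.I * x)).cexp).mul (hw θ)
    refine h2.congr_deriv ?_
    push_cast
    ring
  have hc1 : Continuous fun θ : ℝ =>
      Complex.exp (Complex.I * x * Real.cos θ) * (Real.sin θ * w θ) := by fun_prop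
  have hc2 : Continuous fun θ : ℝ => Complex.exp (Complex.I * x * Real.cos θ) * w' θ := by
    fun_prop
  have h := integral_eq_sub_of_hasDerivAt (fun θ _ => hd θ)
    (((hc1.const_mul (-(Complex.I * x))).add hc2).intervalIntegrable 0 (2 * Real.pi))
  rw [intervalIntegral.integral_add ((hc1.const_mul _).intervalIntegrable _ _)
    (hc2.intervalIntegrable _ _), intervalIntegral.integral_const_mul, hper,
    Real.cos_two_pi, Real.cos_zero, sub_self] at h
  have hne : Complex.I * (x : ℂ) ≠ 0 := mul_ne_zero Complex.I_ne_zero (by exact_mod_cast hx)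
  rw [eq_inv_mul_iff_mul_eq₀ hne]
  linear_combination -h

lemma hasDerivAt_sin_div_sin_sq_add_sq {δ : ℝ} (hδ : 0 < δ) (θ : ℝ) :
    HasDerivAt (fun θ => Real.sin θ / (Real.sin θ ^ 2 + δ ^ 2))
      (Real.cos θ * (δ ^ 2 - Real.sin θ ^ 2) / (Real.sin θ ^ 2 + δ ^ 2) ^ 2) θ := by
  have hpos : 0 < Real.sin θ ^ 2 + δ ^ 2 := by positivity
  have h := (Real.hasDerivAt_sin θ).div
    (((Real.hasDerivAt_sin θ).pow 2).add_const (δ ^ 2)) hpos.ne'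
  refine h.congr_deriv ?_
  simp only [Pi.pow_apply]
  push_cast
  ring

lemma abs_sin_div_sin_sq_add_sq_le {δ : ℝ} (hδ : 0 < δ) (θ : ℝ) :
    |Real.sin θ / (Real.sin θ ^ 2 + δ ^ 2)| ≤ δ⁻¹ := by
  have hpos : 0 < Real.sin θ ^ 2 + δ ^ 2 := by positivity
  rw [abs_div, abs_of_pos hpos, div_le_iff₀ hpos, inv_mul_eq_div, le_div_iff₀ hδ, ← sq_abs]
  nlinarith [sq_nonneg (|Real.sin θ| - δ), abs_nonneg (Real.sin θ)]

lemma abs_deriv_sin_div_sin_sq_add_sq_le {δ : ℝ} (hδ : 0 < δ) (θ : ℝ) :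
    |Real.cos θ * (δ ^ 2 - Real.sin θ ^ 2) / (Real.sin θ ^ 2 + δ ^ 2) ^ 2| ≤
      (Real.sin θ ^ 2 + δ ^ 2)⁻¹ := by
  have hpos : 0 < Real.sin θ ^ 2 + δ ^ 2 := by positivity
  rw [abs_div, abs_mul, abs_of_pos (pow_pos hpos 2), div_le_iff₀ (pow_pos hpos 2), 
    show (Real.sin θ ^ 2 + δ ^ 2)⁻¹ * (Real.sin θ ^ 2 + δ ^ 2) ^ 2 = Real.sin θ ^ 2 + δ ^ 2 by
      field_simp]
  have h1 : |δ ^ 2 - Real.sin θ ^ 2| ≤ Real.sin θ ^ 2 + δ ^ 2 :=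
    abs_le.2 ⟨by nlinarith [sq_nonneg δ], by nlinarith [sq_nonneg (Real.sin θ)]⟩
  calc _ ≤ 1 * (Real.sin θ ^ 2 + δ ^ 2) :=
        mul_le_mul (Real.abs_cos_le_one θ) h1 (abs_nonneg _) zero_le_one
    _ = _ := one_mul _

/-- A stationary phase bound for the phase `cos`. -/
lemma exists_norm_integral_exp_mul_cos_le {v v' : ℝ → ℂ} (hv : ∀ θ, HasDerivAt v (v' θ) θ)
    (hv' : Continuous v') (hper : v (2 * Real.pi) = v 0) :
    ∃ C : ℝ, ∀ x : ℝ, 0 < x →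
      ‖∫ θ in (0 : ℝ)..2 * Real.pi, Complex.exp (Complex.I * x * Real.cos θ) * v θ‖ ≤
        C / √x := by
  have hvc : Continuous v := continuous_iff_continuousAt.2 fun θ => (hv θ).continuousAt
  obtain ⟨M, hM⟩ := (isCompact_Icc (a := (0 : ℝ)) (b := 2 * Real.pi)).exists_bound_of_continuousOn
    hvc.continuousOn
  obtain ⟨M', hM'⟩ :=
    (isCompact_Icc (a := (0 : ℝ)) (b := 2 * Real.pi)).exists_bound_of_continuousOn
    hv'.continuousOn
  have hpi := Real.two_pi_pos
  have hM0 : 0 ≤ M := (norm_nonneg _).trans (hM 0 ⟨le_rfl, hpi.le⟩)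
  have hM0' : 0 ≤ M' := (norm_nonneg _).trans (hM' 0 ⟨le_rfl, hpi.le⟩)
  refine ⟨2 * M * Real.pi ^ 2 + 2 * Real.pi * M', fun x hx => ?_⟩
  -- The width `x^{-1/2}` balances the part near the stationary points, of size `δ`, against the
  -- integrated part, of size `x⁻¹ δ⁻¹`.
  set δ : ℝ := (√x)⁻¹ with hδdef
  have hδ : 0 < δ := by positivity
  have hpos : ∀ θ : ℝ, 0 < Real.sin θ ^ 2 + δ ^ 2 := fun θ => by positivity
  have hinv : Continuous fun θ : ℝ => (Real.sin θ ^ 2 + δ ^ 2)⁻¹ :=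
    Continuous.inv₀ (by fun_prop) fun θ => (hpos θ).ne'
  set q : ℝ → ℝ := fun θ => Real.sin θ / (Real.sin θ ^ 2 + δ ^ 2) with hq
  set q' : ℝ → ℝ := fun θ =>
    Real.cos θ * (δ ^ 2 - Real.sin θ ^ 2) / (Real.sin θ ^ 2 + δ ^ 2) ^ 2 with hq'
  have hqd : ∀ θ, HasDerivAt q (q' θ) θ := hasDerivAt_sin_div_sin_sq_add_sq hδ
  have hqc : Continuous q := continuous_iff_continuousAt.2 fun θ => (hqd θ).continuousAt
  have hqc' : Continuous q' :=
    Continuous.div (by fun_prop) (by fun_prop) fun θ => (pow_pos (hpos θ) 2).ne'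
  have hibp := integral_exp_mul_cos_mul_sin hx.ne' (w := fun θ => (q θ : ℂ) * v θ)
    (fun θ => (hqd θ).ofReal_comp.mul (hv θ)) (by fun_prop)
    (by simp [hq, hper])
  -- A smooth cutoff: `1 = δ²/(sin² θ + δ²) + sin θ · q(θ)`. The first term concentrates at the
  -- stationary points; the second has the factor `sin θ` needed to integrate by parts.
  have hdecomp : ∀ θ : ℝ, Complex.exp (Complex.I * x * Real.cos θ) * v θ =
      Complex.exp (Complex.I * x * Real.cos θ) *
        (((δ ^ 2 * (Real.sin θ ^ 2 + δ ^ 2)⁻¹ : ℝ) : ℂ) * v θ) +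
      Complex.exp (Complex.I * x * Real.cos θ) * (Real.sin θ * ((q θ : ℂ) * v θ)) := fun θ => by
    have : (((δ ^ 2 * (Real.sin θ ^ 2 + δ ^ 2)⁻¹ : ℝ) : ℂ)) + Real.sin θ * (q θ : ℂ) = 1 := by
      rw [← Complex.ofReal_mul, ← Complex.ofReal_add, ← Complex.ofReal_one]
      congr 1
      have := (hpos θ).ne'
      simp only [hq]
      field_simp
      ring
    linear_combination (-Complex.exp (Complex.I * x * Real.cos θ) * v θ) * this
  have hJ := integral_inv_sin_sq_add_sq_le hδ
  have hsq : x⁻¹ = δ ^ 2 := by rw [hδdef, inv_pow, Real.sq_sqrt hx.le]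
  have h1 : ‖∫ θ in (0 : ℝ)..2 * Real.pi, Complex.exp (Complex.I * x * Real.cos θ) *
        (((δ ^ 2 * (Real.sin θ ^ 2 + δ ^ 2)⁻¹ : ℝ) : ℂ) * v θ)‖ ≤ M * Real.pi ^ 2 * δ := by
    calc _ ≤ ∫ θ in (0 : ℝ)..2 * Real.pi, M * δ ^ 2 * (Real.sin θ ^ 2 + δ ^ 2)⁻¹ := by
          refine norm_integral_le_of_norm_le hpi.le (Filter.Eventually.of_forall fun θ hθ => ?_)
            ((hinv.const_mul _).intervalIntegrable _ _)
          rw [norm_mul, norm_exp_mul_cos, one_mul, norm_mul, Complex.norm_real, Real.norm_eq_abs,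
            abs_of_pos (mul_pos (pow_pos hδ 2) (inv_pos.2 (hpos θ)))]
          have := hM θ ⟨hθ.1.le, hθ.2⟩
          have h3 := mul_pos (pow_pos hδ 2) (inv_pos.2 (hpos θ))
          nlinarith
      _ = M * δ ^ 2 * ∫ θ in (0 : ℝ)..2 * Real.pi, (Real.sin θ ^ 2 + δ ^ 2)⁻¹ :=
          intervalIntegral.integral_const_mul _ _
      _ ≤ M * δ ^ 2 * (Real.pi ^ 2 / δ) := by gcongr
      _ = _ := by field_simp
  have h2 : ‖∫ θ in (0 : ℝ)..2 * Real.pi, Complex.exp (Complex.I * x * Real.cos θ) *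
        ((q' θ : ℂ) * v θ + (q θ : ℂ) * v' θ)‖ ≤
        M * (Real.pi ^ 2 / δ) + 2 * Real.pi * (M' * δ⁻¹) := by
    calc _ ≤ ∫ θ in (0 : ℝ)..2 * Real.pi, (M * (Real.sin θ ^ 2 + δ ^ 2)⁻¹ + M' * δ⁻¹) := by
          refine norm_integral_le_of_norm_le hpi.le (Filter.Eventually.of_forall fun θ hθ => ?_)
            (((hinv.const_mul _).add continuous_const).intervalIntegrable _ _)
          rw [norm_mul, norm_exp_mul_cos, one_mul]
          refine (norm_add_le _ _).trans (add_le_add ?_ ?_)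
          · rw [norm_mul, Complex.norm_real, Real.norm_eq_abs, mul_comm]
            exact mul_le_mul (hM θ ⟨hθ.1.le, hθ.2⟩) (abs_deriv_sin_div_sin_sq_add_sq_le hδ θ)
              (abs_nonneg _) hM0
          · rw [norm_mul, Complex.norm_real, Real.norm_eq_abs, mul_comm]
            exact mul_le_mul (hM' θ ⟨hθ.1.le, hθ.2⟩) (abs_sin_div_sin_sq_add_sq_le hδ θ)
              (abs_nonneg _) hM0'
      _ = M * (∫ θ in (0 : ℝ)..2 * Real.pi, (Real.sin θ ^ 2 + δ ^ 2)⁻¹) +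
          2 * Real.pi * (M' * δ⁻¹) := by
          rw [intervalIntegral.integral_add ((hinv.const_mul _).intervalIntegrable _ _)
            (continuous_const.intervalIntegrable _ _), intervalIntegral.integral_const_mul,
            intervalIntegral.integral_const, sub_zero, smul_eq_mul]
      _ ≤ _ := by gcongr
  simp_rw [hdecomp]
  rw [intervalIntegral.integral_add (Continuous.intervalIntegrable (by fun_prop) _ _)
    (Continuous.intervalIntegrable (by fun_prop) _ _), hibp]
  refine (norm_add_le _ _).trans ((add_le_add h1
    (?_ : _ ≤ M * Real.pi ^ 2 * δ + 2 * Real.pi * M' * δ)).trans_eq ?_)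
  · rw [norm_mul, norm_inv, norm_mul, Complex.norm_I, one_mul, Complex.norm_real,
      Real.norm_of_nonneg hx.le, hsq]
    refine (mul_le_mul_of_nonneg_left h2 (by positivity)).trans_eq ?_
    field_simp
  · rw [div_eq_mul_inv, ← hδdef]; ring

/-- The improved decay when the amplitude vanishes at the stationary points. -/
lemma exists_norm_integral_exp_mul_cos_mul_sin_le {u : ℝ → ℂ} (hu : ContDiff ℝ 2 u)
    (hper : Function.Periodic u (2 * Real.pi)) :
    ∃ C : ℝ, ∀ x : ℝ, 0 < x →
      ‖∫ θ in (0 : ℝ)..2 * Real.pi,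
        Complex.exp (Complex.I * x * Real.cos θ) * (Real.sin θ * u θ)‖ ≤ C / (x * √x) := by
  have hu1 : ContDiff ℝ 1 (deriv u) := hu.deriv'
  have hd : ∀ θ, HasDerivAt u (deriv u θ) θ := fun θ =>
    (hu.differentiable (by norm_num) θ).hasDerivAt
  have hd' : ∀ θ, HasDerivAt (deriv u) (deriv (deriv u) θ) θ := fun θ =>
    (hu1.differentiable (by norm_num) θ).hasDerivAt
  have hperd : deriv u (2 * Real.pi) = deriv u 0 := by
    have h := deriv_comp_add_const u (2 * Real.pi) 0
    rw [zero_add] at h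
    rw [← h]
    exact congrArg (deriv · 0) (funext hper)
  obtain ⟨C, hC⟩ := exists_norm_integral_exp_mul_cos_le hd' (hu1.continuous_deriv le_rfl) hperd
  refine ⟨C, fun x hx => ?_⟩
  rw [integral_exp_mul_cos_mul_sin hx.ne' hd hu1.continuous (by simpa using hper 0), norm_mul,
    norm_inv, norm_mul, Complex.norm_I, one_mul, Complex.norm_real, Real.norm_of_nonneg hx.le]
  refine (mul_le_mul_of_nonneg_left (hC x hx) (by positivity)).trans_eq ?_
  field_simp

/-! ### Moments and exponentials as trigonometric integrals -/

lemma circleMap_zero_one_add_inv (θ : ℝ) :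
    circleMap 0 1 θ + (circleMap 0 1 θ)⁻¹ = 2 * Real.cos θ := by
  simp only [circleMap, Complex.ofReal_one, one_mul, zero_add]
  rw [← Complex.exp_neg, Complex.ofReal_cos, Complex.cos]
  ring_nf

lemma circleMap_zero_one_sub_inv (θ : ℝ) :
    circleMap 0 1 θ - (circleMap 0 1 θ)⁻¹ = 2 * Real.sin θ * Complex.I := by
  simp only [circleMap, Complex.ofReal_one, one_mul, zero_add]
  rw [← Complex.exp_neg, Complex.ofReal_sin, Complex.sin]
  ring_nf
  rw [Complex.I_sq]
  ring_nf

/-- Cauchy's formula in terms of the spectral parameter `c (ζ + ζ⁻¹)`. -/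
lemma eq_integral_sin_mul_circleMap {Φ Ψ : ℂ → ℂ} {a c : ℂ}
    (hΦ : DiffContOnCl ℂ Φ (Metric.ball 0 1)) (hΨ : DiffContOnCl ℂ Ψ (Metric.ball 0 1))
    (hΨ0 : Ψ 0 = 0)
    (h : ∀ ζ : ℂ, ‖ζ‖ = 1 → Ψ ζ = c * (ζ + ζ⁻¹) * Φ ζ + a) :
    a = Complex.I * c / Real.pi *
      ∫ θ in (0 : ℝ)..2 * Real.pi, Real.sin θ * Φ (circleMap 0 1 θ) := by
  have hΦ0 := hΦ.circleIntegral_eq_zero zero_le_one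
  have hΨa := (hΨ.sub_const a).circleIntegral_sub_inv_smul (Metric.mem_ball_self one_pos)
  have hcont : ∀ {F : ℂ → ℂ}, DiffContOnCl ℂ F (Metric.ball 0 1) →
      CircleIntegrable F 0 1 := fun hF => by
    refine ContinuousOn.circleIntegrable zero_le_one (hF.continuousOn.mono ?_)
    rw [closure_ball _ one_ne_zero]
    exact Metric.sphere_subset_closedBall
  have hint : CircleIntegrable (fun z => (z - 0)⁻¹ • (Ψ z - a)) 0 1 := by
    refine ContinuousOn.circleIntegrable zero_le_one (ContinuousOn.fun_smul ?_ ?_)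
    · refine ContinuousOn.inv₀ (by fun_prop) fun z hz => ?_
      rw [sub_zero]
      rintro rfl
      simp at hz
    · refine (hΨ.sub_const a).continuousOn.mono ?_
      rw [closure_ball _ one_ne_zero]
      exact Metric.sphere_subset_closedBall
  -- On the circle this integrand equals `c (1 - z⁻²) Φ z`, and `dz = i z dθ` turns `z - z⁻¹` into
  -- `2 i sin θ`. By Cauchy the term `2 c Φ` contributes nothing, and the other picks out `Ψ 0 - a =
  -- -a`.
  have hI : ∮ z in C(0, 1), (2 * c * Φ z - (z - 0)⁻¹ • (Ψ z - a)) =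
      2 * Real.pi * Complex.I * a := by
    rw [circleIntegral.integral_sub (f := fun z => 2 * c * Φ z)
      ((hcont hΦ).const_smul (a := 2 * c)) hint,
      circleIntegral.integral_const_mul, hΦ0, hΨa, hΨ0, smul_eq_mul]
    ring
  rw [circleIntegral] at hI
  have hpt : ∀ θ : ℝ, deriv (circleMap 0 1) θ • (2 * c * Φ (circleMap 0 1 θ) -
      (circleMap 0 1 θ - 0)⁻¹ • (Ψ (circleMap 0 1 θ) - a)) =
      -(2 * c) * (Real.sin θ * Φ (circleMap 0 1 θ)) := fun θ => by
    rw [h _ (by simp), deriv_circleMap, sub_zero, smul_eq_mul, smul_eq_mul]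
    have h1 : circleMap 0 1 θ * (circleMap 0 1 θ)⁻¹ = 1 :=
      mul_inv_cancel₀ (circleMap_ne_center one_ne_zero)
    have h2 := circleMap_zero_one_sub_inv θ
    linear_combination (Complex.I * c * Φ (circleMap 0 1 θ)) * h2 -
      Complex.I * c * Φ (circleMap 0 1 θ) * (circleMap 0 1 θ + (circleMap 0 1 θ)⁻¹) * h1 +
      2 * c * Real.sin θ * Φ (circleMap 0 1 θ) * Complex.I_sq
  simp_rw [hpt] at hI
  rw [intervalIntegral.integral_const_mul] at hI
  have hpi : (Real.pi : ℂ) ≠ 0 := by exact_mod_cast Real.pi_ne_zero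
  field_simp
  linear_combination (Complex.I / 2) * hI + (a * Real.pi) * Complex.I_sq

/-- The integrand is an exact derivative of a periodic function. This removes the inhomogeneous term
of the resolvent recursion in the induction on moments. -/
lemma integral_const_mul_cos_pow_mul_sin (c : ℂ) (n : ℕ) :
    ∫ θ in (0 : ℝ)..2 * Real.pi, (c * Real.cos θ) ^ n * Real.sin θ = 0 := by
  have hd : ∀ θ : ℝ, HasDerivAt (fun θ : ℝ => -(c ^ n * (Real.cos θ : ℂ) ^ (n + 1) / (n + 1)))
      ((c * Real.cos θ) ^ n * Real.sin θ) θ := fun θ => by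
    have h1 : HasDerivAt (fun θ : ℝ => ((Real.cos θ : ℝ) : ℂ)) ((-Real.sin θ : ℝ) : ℂ) θ :=
      (Real.hasDerivAt_cos θ).ofReal_comp
    have hn : ((n : ℂ) + 1) ≠ 0 := Nat.cast_add_one_ne_zero n
    refine (((h1.pow (n + 1)).const_mul (c ^ n)).div_const ((n : ℂ) + 1)).neg.congr_deriv ?_
    push_cast
    field_simp
    ring
  rw [integral_eq_sub_of_hasDerivAt (fun θ _ => hd θ)
    (Continuous.intervalIntegrable (by fun_prop) _ _)]
  simp

/-- If `Φ x` is holomorphic on the closed unit disc and satisfies the resolvent recursion for `H`,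
then the moments `a (Hⁿ x)` are trigonometric integrals. -/
lemma iterate_eq_integral {X : Type*} {H : X → X} {p : X → Prop} (hp : ∀ x, p x → p (H x))
    {Φ : X → ℂ → ℂ} {a : X → ℂ} {c : ℂ}
    (hΦ : ∀ x, p x → DifferentiableOn ℂ (Φ x) (Metric.closedBall 0 1))
    (h0 : ∀ x, Φ x 0 = 0)
    (h : ∀ x, p x → ∀ ζ : ℂ, ‖ζ‖ = 1 → Φ (H x) ζ = c * (ζ + ζ⁻¹) * Φ x ζ + a x)
    (n : ℕ) : ∀ x, p x → a (H^[n] x) = Complex.I * c / Real.pi *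
      ∫ θ in (0 : ℝ)..2 * Real.pi,
        (2 * c * Real.cos θ) ^ n * (Real.sin θ * Φ x (circleMap 0 1 θ)) := by
  have hcl : ∀ x, p x → DiffContOnCl ℂ (Φ x) (Metric.ball 0 1) := fun x hx => by
    refine DifferentiableOn.diffContOnCl ?_
    rw [closure_ball _ one_ne_zero]
    exact hΦ x hx
  have hcont : ∀ x, p x → Continuous fun θ : ℝ => Φ x (circleMap 0 1 θ) := fun x hx =>
    (hΦ x hx).continuousOn.comp_continuous (continuous_circleMap 0 1) fun θ =>
      circleMap_mem_closedBall 0 zero_le_one θ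
  induction n with
  | zero =>
    intro x hx
    simpa using eq_integral_sin_mul_circleMap (hcl x hx) (hcl _ (hp x hx)) (h0 _) (h x hx)
  | succ n ih =>
    intro x hx
    have hc2 := hcont _ (hp x hx)
    rw [Function.iterate_succ_apply, ih _ (hp x hx)]
    congr 1
    have hpt : ∀ θ : ℝ, (2 * c * Real.cos θ) ^ (n + 1) *
        (Real.sin θ * Φ x (circleMap 0 1 θ)) =
        (2 * c * Real.cos θ) ^ n * (Real.sin θ * Φ (H x) (circleMap 0 1 θ)) -
          a x * ((2 * c * Real.cos θ) ^ n * Real.sin θ) := fun θ => by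
      rw [h x hx _ (by simp), circleMap_zero_one_add_inv]
      ring
    simp_rw [hpt]
    have hc3 : Continuous fun θ : ℝ => (2 * c * Real.cos θ) ^ n *
        (Real.sin θ * Φ (H x) (circleMap 0 1 θ)) :=
      Continuous.mul (by fun_prop) (Continuous.mul (by fun_prop) hc2)
    rw [intervalIntegral.integral_sub (hc3.intervalIntegrable _ _)
      (Continuous.intervalIntegrable (by fun_prop) _ _), intervalIntegral.integral_const_mul,
      integral_const_mul_cos_pow_mul_sin, mul_zero, sub_zero]

/-- Summation of the exponential series under the integral sign. -/
lemma hasSum_integral_exp_mul_cos (x : ℝ) {u : ℝ → ℂ} (hu : Continuous u) :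
    HasSum (fun n : ℕ => ((n.factorial : ℂ)⁻¹ * Complex.I ^ n) *
        ∫ θ in (0 : ℝ)..2 * Real.pi, (x * Real.cos θ : ℂ) ^ n * u θ)
      (∫ θ in (0 : ℝ)..2 * Real.pi, Complex.exp (Complex.I * x * Real.cos θ) * u θ) := by
  simp_rw [← intervalIntegral.integral_const_mul]
  have hsum : Summable fun n : ℕ => |x| ^ n / n.factorial := Real.summable_pow_div_factorial |x|
  refine intervalIntegral.hasSum_integral_of_dominated_convergence
    (fun n θ => |x| ^ n / n.factorial * ‖u θ‖) (fun n => ?_) (fun n => ?_) ?_ ?_ ?_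
  · exact (Continuous.aestronglyMeasurable (by fun_prop))
  · refine Filter.Eventually.of_forall fun θ _ => ?_
    simp only [norm_mul, norm_inv, norm_pow, Complex.norm_I, one_pow, mul_one, Complex.norm_natCast,
      Complex.norm_real, Real.norm_eq_abs]
    rw [← mul_assoc, div_eq_inv_mul]
    have h1 := Real.abs_cos_le_one θ
    gcongr
    exact mul_le_of_le_one_right (abs_nonneg _) h1
  · exact Filter.Eventually.of_forall fun θ _ => hsum.mul_right _
  · simp_rw [tsum_mul_right]
    exact Continuous.intervalIntegrable (by fun_prop) _ _
  · refine Filter.Eventually.of_forall fun θ _ => ?_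
    have h := (NormedSpace.expSeries_div_hasSum_exp (𝔸 := ℂ)
      (Complex.I * x * Real.cos θ)).mul_right (u θ)
    rw [← Complex.exp_eq_exp_ℂ] at h
    have hfun : (fun n : ℕ => (n.factorial : ℂ)⁻¹ * Complex.I ^ n * ((x * Real.cos θ : ℂ) ^ n * u θ)) =
        fun n => (Complex.I * x * Real.cos θ) ^ n / n.factorial * u θ := funext fun n => by ring
    rw [hfun]
    exact h

end

/-! ### The coupled system -/

noncomputable section

namespace System

open ComplexConjugate

variable {N : ℕ}

lemma inner_eq_sum (f g : System N) :
    inner ℂ f g = ∑ j : Fin 2, inner ℂ (leadProj j f) (leadProj j g) +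
      inner ℂ (sampleProj f) (sampleProj g) := rfl

lemma leadProj_leadIncl_self (j : Fin 2) (ψ : Lead) :
    leadProj j (leadIncl j ψ : System N) = ψ := by
  change (Pi.single j ψ : Fin 2 → Lead) j = ψ
  exact Pi.single_eq_same (M := fun _ => Lead) j ψ

lemma leadProj_leadIncl_of_ne {j k : Fin 2} (h : k ≠ j) (ψ : Lead) :
    leadProj k (leadIncl j ψ : System N) = 0 := by
  change (Pi.single j ψ : Fin 2 → Lead) k = 0
  exact Pi.single_eq_of_ne (M := fun _ => Lead) h ψ

lemma sampleProj_leadIncl (j : Fin 2) (ψ : Lead) :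
    sampleProj (leadIncl j ψ : System N) = 0 := rfl

lemma leadProj_sampleIncl (j : Fin 2) (v : Sample N) : leadProj j (sampleIncl v) = 0 := rfl

lemma sampleProj_sampleIncl (v : Sample N) : sampleProj (sampleIncl v) = v := rfl

lemma inner_leadIncl_left (j : Fin 2) (ψ : Lead) (g : System N) :
    inner ℂ (leadIncl j ψ) g = inner ℂ ψ (leadProj j g) := by
  rw [inner_eq_sum, Finset.sum_eq_single j, leadProj_leadIncl_self, sampleProj_leadIncl,
    inner_zero_left, add_zero]
  · intro k _ hk
    rw [leadProj_leadIncl_of_ne hk, inner_zero_left]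
  · simp

lemma inner_sampleIncl_left (v : Sample N) (g : System N) :
    inner ℂ (sampleIncl v) g = inner ℂ v (sampleProj g) := by
  simp only [inner_eq_sum, leadProj_sampleIncl, sampleProj_sampleIncl, inner_zero_left,
    Finset.sum_const_zero, zero_add]

variable (tc τ : ℝ) (hs : Sample N →L[ℂ] Sample N) (S : Fin 2 → Sample N) (L : Fin 2 → Lead)

lemma hamiltonian_apply (g : System N) :
    hamiltonian tc τ hs S L g =
      ∑ j : Fin 2, leadIncl j (Lead.laplacian tc (leadProj j g)) + sampleIncl (hs (sampleProj g)) +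
      (τ : ℂ) • ∑ j : Fin 2, (inner ℂ (L j) (leadProj j g) • sampleIncl (S j) +
        inner ℂ (S j) (sampleProj g) • leadIncl j (L j)) := by
  simp only [hamiltonian, tunneling, add_apply, smul_apply, sum_apply,
    ContinuousLinearMap.comp_apply, InnerProductSpace.rankOne_apply, inner_leadIncl_left,
    inner_sampleIncl_left]

lemma leadProj_hamiltonian (j : Fin 2) (g : System N) :
    leadProj j (hamiltonian tc τ hs S L g) =
      Lead.laplacian tc (leadProj j g) + ((τ : ℂ) * inner ℂ (S j) (sampleProj g)) • L j := by
  rw [hamiltonian_apply]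
  have h1 : ∑ k : Fin 2, leadProj j (leadIncl k (Lead.laplacian tc (leadProj k g)) : System N) =
      Lead.laplacian tc (leadProj j g) := by
    rw [Finset.sum_eq_single j, leadProj_leadIncl_self]
    · exact fun k _ hk => leadProj_leadIncl_of_ne hk.symm _
    · simp
  have h2 : ∑ k : Fin 2, (inner ℂ (S k) (sampleProj g)) • leadProj j (leadIncl k (L k) : System N) =
      (inner ℂ (S j) (sampleProj g)) • L j := by
    rw [Finset.sum_eq_single j, leadProj_leadIncl_self]
    · intro k _ hk
      rw [leadProj_leadIncl_of_ne hk.symm, smul_zero]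
    · simp
  simp only [map_add, map_sum, map_smul, leadProj_sampleIncl, smul_zero, zero_add, add_zero, h1, h2,
    smul_smul]

lemma sampleProj_hamiltonian (g : System N) :
    sampleProj (hamiltonian tc τ hs S L g) =
      hs (sampleProj g) + (τ : ℂ) • ∑ j : Fin 2, inner ℂ (L j) (leadProj j g) • S j := by
  rw [hamiltonian_apply]
  simp only [map_add, map_sum, map_smul, sampleProj_leadIncl, sampleProj_sampleIncl, smul_zero,
    Finset.sum_const_zero, zero_add, add_zero]

variable {tc τ hs S L}

lemma CompactlySupported.hamiltonian (hL : ∀ j, (L j).CompactlySupported) {g : System N}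
    (hg : g.CompactlySupported) : (hamiltonian tc τ hs S L g).CompactlySupported := fun j => by
  rw [leadProj_hamiltonian]
  exact ((hg j).laplacian tc).add ((hL j).smul _)

lemma isSelfAdjoint_hamiltonian (h : IsSelfAdjoint hs) :
    IsSelfAdjoint (hamiltonian tc τ hs S L) := by
  have hs' : ∀ v w, inner ℂ (hs v) w = inner ℂ v (hs w) :=
    (ContinuousLinearMap.isSelfAdjoint_iff_isSymmetric.1 h)
  refine ContinuousLinearMap.isSelfAdjoint_iff_isSymmetric.2 fun f g => ?_
  change inner ℂ (hamiltonian tc τ hs S L f) g = inner ℂ f (hamiltonian tc τ hs S L g)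
  simp only [inner_eq_sum, leadProj_hamiltonian, sampleProj_hamiltonian, inner_add_left,
    inner_add_right, inner_smul_left, inner_smul_right, hs',
    Lead.inner_laplacian_right, map_mul, inner_conj_symm, Complex.conj_ofReal, Fin.sum_univ_two]
  ring

/-! ### Feshbach reduction, continued in `ζ` -/

variable (tc τ hs S L)

/-- The operator `ζ S(z)` at `z = tc (ζ + ζ⁻¹)`, continued to all `ζ`. -/
def scaledFeshbach (ζ : ℂ) : Sample N →L[ℂ] Sample N :=
  ζ • hs - ((tc : ℂ) * (ζ ^ 2 + 1)) • (1 : Sample N →L[ℂ] Sample N) -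
    (ζ * (τ : ℂ) ^ 2) • ∑ j : Fin 2,
      Lead.resolventForm tc (L j) (L j) ζ • InnerProductSpace.rankOne ℂ (S j) (S j)

/-- The sample component of the resolvent applied to `g`. -/
def resolventSample (g : System N) (ζ : ℂ) : Sample N :=
  ζ • Ring.inverse (scaledFeshbach tc τ hs S L ζ)
    (sampleProj g - (τ : ℂ) • ∑ j : Fin 2,
      Lead.resolventForm tc (L j) (leadProj j g) ζ • S j)

/-- The matrix element `⟨f, (H - z)⁻¹ g⟩` at `z = tc (ζ + ζ⁻¹)`, continued to all `ζ`. -/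
def resolventElement (f g : System N) (ζ : ℂ) : ℂ :=
  ∑ j : Fin 2, (Lead.resolventForm tc (leadProj j f) (leadProj j g) ζ -
    (τ : ℂ) * inner ℂ (S j) (resolventSample tc τ hs S L g ζ) *
      Lead.resolventForm tc (leadProj j f) (L j) ζ) +
    inner ℂ (sampleProj f) (resolventSample tc τ hs S L g ζ)

variable {tc τ hs S L}

lemma resolventElement_zero (f g : System N) : resolventElement tc τ hs S L f g 0 = 0 := by
  simp [resolventElement, resolventSample, Lead.resolventForm]

/-- The sample component of `(H - z)⁻¹ H g = g + z (H - z)⁻¹ g`. It is derived from the Feshbach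
formula alone, so only invertibility of the Feshbach operator at `ζ` is needed and points of the
circle are allowed. -/
lemma resolventSample_hamiltonian (htc : tc ≠ 0) (hL : ∀ j, (L j).CompactlySupported)
    {g : System N} (hg : g.CompactlySupported) {ζ : ℂ} (hζ : ζ ≠ 0)
    (hu : IsUnit (scaledFeshbach tc τ hs S L ζ)) :
    resolventSample tc τ hs S L (hamiltonian tc τ hs S L g) ζ =
      sampleProj g + ((tc : ℂ) * (ζ + ζ⁻¹)) • resolventSample tc τ hs S L g ζ := by
  have hl : ∀ v, Ring.inverse (scaledFeshbach tc τ hs S L ζ) (scaledFeshbach tc τ hs S L ζ v) = v :=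
    fun v => congrArg (fun A : Sample N →L[ℂ] Sample N => A v) (Ring.inverse_mul_cancel _ hu)
  have hr : ∀ v, scaledFeshbach tc τ hs S L ζ (Ring.inverse (scaledFeshbach tc τ hs S L ζ) v) = v :=
    fun v => congrArg (fun A : Sample N →L[ℂ] Sample N => A v) (Ring.mul_inverse_cancel _ hu)
  -- With the right side written as `F⁻¹ (F ·)`, where `F` is the scaled Feshbach operator, it
  -- remains to compare the arguments of `F⁻¹`.
  rw [← hl (sampleProj g + _), map_add, map_smul]
  conv_rhs => rw [resolventSample, map_smul, hr]
  rw [resolventSample, ← map_smul]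
  congr 1
  have hB : ∀ j, Lead.resolventForm tc (L j)
      (leadProj j (hamiltonian tc τ hs S L g)) ζ =
      (tc : ℂ) * (ζ + ζ⁻¹) * Lead.resolventForm tc (L j) (leadProj j g) ζ +
        inner ℂ (L j) (leadProj j g) + (τ : ℂ) * inner ℂ (S j) (sampleProj g) *
        Lead.resolventForm tc (L j) (L j) ζ := fun j => by
    rw [leadProj_hamiltonian, Lead.resolventForm_add tc _ ((hg j).laplacian tc) ((hL j).smul _),
      Lead.resolventForm_laplacian htc (hL j) (hg j) hζ, Lead.resolventForm_smul]
  simp only [hB, sampleProj_hamiltonian, scaledFeshbach, sub_apply,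
    smul_apply, one_apply_eq_self, 
    InnerProductSpace.rankOne_apply, Fin.sum_univ_two, add_apply]
  match_scalars <;> field_simp <;> ring

lemma resolventElement_hamiltonian (htc : tc ≠ 0) (hL : ∀ j, (L j).CompactlySupported)
    {f g : System N} (hf : f.CompactlySupported) (hg : g.CompactlySupported) {ζ : ℂ} (hζ : ζ ≠ 0)
    (hu : IsUnit (scaledFeshbach tc τ hs S L ζ)) :
    resolventElement tc τ hs S L f (hamiltonian tc τ hs S L g) ζ =
      (tc : ℂ) * (ζ + ζ⁻¹) * resolventElement tc τ hs S L f g ζ + inner ℂ f g := by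
  have hB : ∀ j, Lead.resolventForm tc (leadProj j f)
      (leadProj j (hamiltonian tc τ hs S L g)) ζ =
      (tc : ℂ) * (ζ + ζ⁻¹) * Lead.resolventForm tc (leadProj j f) (leadProj j g) ζ +
        inner ℂ (leadProj j f) (leadProj j g) + (τ : ℂ) * inner ℂ (S j) (sampleProj g) *
        Lead.resolventForm tc (leadProj j f) (L j) ζ := fun j => by
    rw [leadProj_hamiltonian, Lead.resolventForm_add tc _ ((hg j).laplacian tc) ((hL j).smul _),
      Lead.resolventForm_laplacian htc (hf j) (hg j) hζ, Lead.resolventForm_smul]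
  simp only [resolventElement, hB, resolventSample_hamiltonian htc hL hg hζ hu, inner_eq_sum f g,
    inner_add_right, inner_smul_right, Fin.sum_univ_two]
  ring

lemma contDiff_scaledFeshbach (hL : ∀ j, (L j).CompactlySupported) {n : WithTop ℕ∞} :
    ContDiff ℂ n (scaledFeshbach tc τ hs S L) := by
  have := fun j => Lead.contDiff_resolventForm (n := n) tc (hL j) (hL j)
  unfold scaledFeshbach
  fun_prop

lemma contDiffAt_resolventElement (hL : ∀ j, (L j).CompactlySupported)
    {f g : System N} (hf : f.CompactlySupported) (hg : g.CompactlySupported) {ζ : ℂ}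
    (hu : IsUnit (scaledFeshbach tc τ hs S L ζ)) {n : WithTop ℕ∞} :
    ContDiffAt ℂ n (resolventElement tc τ hs S L f g) ζ := by
  have h1 := fun j => (Lead.contDiff_resolventForm (n := n) tc (hL j) (hg j)).contDiffAt (x := ζ)
  have h2 := fun j => (Lead.contDiff_resolventForm (n := n) tc (hf j) (hg j)).contDiffAt (x := ζ)
  have h3 := fun j => (Lead.contDiff_resolventForm (n := n) tc (hf j) (hL j)).contDiffAt (x := ζ)
  have h4 : ContDiffAt ℂ n (fun ζ => Ring.inverse (scaledFeshbach tc τ hs S L ζ)) ζ := by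
    obtain ⟨u, hu⟩ := hu
    refine ContDiffAt.comp (g := Ring.inverse) ζ ?_ (contDiff_scaledFeshbach hL).contDiffAt
    rw [← hu]
    exact contDiffAt_ringInverse ℂ u
  have h5 : ContDiffAt ℂ n (resolventSample tc τ hs S L g) ζ := by
    unfold resolventSample
    exact contDiffAt_id.fun_smul (h4.clm_apply (contDiffAt_const.sub (contDiffAt_const.fun_smul
      (ContDiffAt.sum fun j _ => (h1 j).fun_smul contDiffAt_const))))
  have h6 : ∀ v : Sample N, ContDiffAt ℂ n
      (fun ζ => inner ℂ v (resolventSample tc τ hs S L g ζ)) ζ := fun v =>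
    (innerSL ℂ v).contDiff.contDiffAt.comp ζ h5
  unfold resolventElement
  exact (ContDiffAt.sum fun j _ => (h2 j).sub ((contDiffAt_const.mul (h6 _)).mul (h3 j))).add (h6 _)

/-! ### Invertibility of the Feshbach operator on the closed disc -/

/-- Carries invertibility from the lower semicircle, where the `+i0` hypothesis applies, to the
upper one. -/
lemma scaledFeshbach_conj (h : IsSelfAdjoint hs) (ζ : ℂ) :
    scaledFeshbach tc τ hs S L (conj ζ) = star (scaledFeshbach tc τ hs S L ζ) := by
  refine (ContinuousLinearMap.eq_adjoint_iff _ _).2 fun v w => ?_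
  have hs' : ∀ v w, inner ℂ (hs v) w = inner ℂ v (hs w) :=
    (ContinuousLinearMap.isSelfAdjoint_iff_isSymmetric.1 h)
  simp only [scaledFeshbach, sub_apply, smul_apply, one_apply_eq_self, Fin.sum_univ_two, add_apply,
    InnerProductSpace.rankOne_apply, inner_sub_left, inner_sub_right, inner_add_left,
    inner_add_right, inner_smul_left, inner_smul_right, Lead.resolventForm_conj, hs', map_mul,
    map_pow, map_add, map_one, Complex.conj_conj, Complex.conj_ofReal, inner_conj_symm]
  ring

/-- The factor `ζ` clears the pole of `z = tc (ζ + ζ⁻¹)` at `ζ = 0`. The condition on `ζ` selects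
the preimage of `E` that the `+i0` limit approaches. -/
lemma feshbachMatrix_eq (htc : 0 < tc) (hL : ∀ j, (L j).CompactlySupported) {ζ : ℂ}
    (hζ0 : ζ ≠ 0) (h : ‖ζ‖ < 1 ∨ ‖ζ‖ = 1 ∧ ζ.im ≤ 0) {E : ℝ} (hE : (tc : ℂ) * (ζ + ζ⁻¹) = E) :
    scaledFeshbach tc τ hs S L ζ = ζ • feshbachMatrix tc τ hs S L E := by
  simp only [scaledFeshbach, feshbachMatrix, Lead.boundaryResolvent_eq htc (hL _) hζ0 h hE, ← hE,
    smul_sub, smul_smul]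
  congr 3
  field_simp

/-- For `v` in the kernel, the imaginary part of `⟨v, S(z) v⟩ = 0` is `-Im z (‖v‖² + τ² ∑ⱼ |⟨Sⱼ,
v⟩|² rⱼ)` with `rⱼ ≥ 0` by the Herglotz property, which forces `v = 0`; finite dimension does the
rest. -/
lemma isUnit_scaledFeshbach_of_im_ne_zero (htc : tc ≠ 0) (h : IsSelfAdjoint hs)
    (hL : ∀ j, (L j).CompactlySupported) {ζ : ℂ} (hζ0 : ζ ≠ 0) (hζ : ‖ζ‖ < 1)
    (him : ((tc : ℂ) * (ζ + ζ⁻¹)).im ≠ 0) : IsUnit (scaledFeshbach tc τ hs S L ζ) := by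
  have hinj : Function.Injective (scaledFeshbach tc τ hs S L ζ) := by
    refine (injective_iff_map_eq_zero _).2 fun v hv => ?_
    choose r hr0 hr using fun j => Lead.exists_im_resolventForm_eq htc (hL j) hζ0 hζ
    have hreal : (inner ℂ v (hs v)).im = 0 := by
      rw [← Complex.conj_eq_iff_im, inner_conj_symm]
      exact ContinuousLinearMap.isSelfAdjoint_iff_isSymmetric.1 h v v
    have h1 : inner ℂ v (hs v) - (tc : ℂ) * (ζ + ζ⁻¹) * ((‖v‖ ^ 2 : ℝ) : ℂ) -
        ((τ ^ 2 : ℝ) : ℂ) * ∑ j : Fin 2, ((‖inner ℂ (S j) v‖ ^ 2 : ℝ) : ℂ) *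
          Lead.resolventForm tc (L j) (L j) ζ = 0 := by
      have h2 : ζ⁻¹ * inner ℂ v (scaledFeshbach tc τ hs S L ζ v) = 0 := by
        rw [hv, inner_zero_right, mul_zero]
      rw [← h2]
      have h3 : ∀ j, ((‖inner ℂ (S j) v‖ ^ 2 : ℝ) : ℂ) =
          inner ℂ v (S j) * inner ℂ (S j) v := fun j => by
        rw [← Complex.normSq_eq_norm_sq, ← Complex.mul_conj, inner_conj_symm, mul_comm]
      have h4 : ((‖v‖ ^ 2 : ℝ) : ℂ) = inner ℂ v v := by
        rw [inner_self_eq_norm_sq_to_K]; simp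
      simp only [h3, h4, scaledFeshbach, sub_apply,
        smul_apply, one_apply_eq_self,
        InnerProductSpace.rankOne_apply, Fin.sum_univ_two,
        inner_sub_right, inner_smul_right, inner_add_right, add_apply]
      push_cast
      field_simp
    have h2 := congrArg Complex.im h1
    simp only [Complex.sub_im, Complex.im_mul_ofReal, Complex.im_ofReal_mul, Complex.im_sum,
      hreal, hr, Complex.zero_im] at h2
    have h3 : ((tc : ℂ) * (ζ + ζ⁻¹)).im *
        (‖v‖ ^ 2 + τ ^ 2 * ∑ j : Fin 2, ‖inner ℂ (S j) v‖ ^ 2 * r j) = 0 := by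
      simp only [Fin.sum_univ_two] at h2 ⊢
      rw [← Complex.im_ofReal_mul] at h2
      linear_combination -h2
    have h4 := (mul_eq_zero.1 h3).resolve_left him
    have h5 : 0 ≤ τ ^ 2 * ∑ j : Fin 2, ‖inner ℂ (S j) v‖ ^ 2 * r j :=
      mul_nonneg (sq_nonneg _) (Finset.sum_nonneg fun j _ => mul_nonneg (sq_nonneg _) (hr0 j))
    have h6 : ‖v‖ ^ 2 = 0 := le_antisymm (by linarith) (sq_nonneg _)
    simpa using h6
  refine ContinuousLinearMap.isUnit_iff_bijective.2 ⟨hinj, ?_⟩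
  exact LinearMap.injective_iff_surjective (f := (scaledFeshbach tc τ hs S L ζ).toLinearMap).1 hinj

lemma isUnit_scaledFeshbach (htc : 0 < tc) (h : IsSelfAdjoint hs)
    (hL : ∀ j, (L j).CompactlySupported)
    (hS : ∀ E : ℝ, IsUnit (feshbachMatrix tc τ hs S L E)) {ζ : ℂ} (hζ : ‖ζ‖ ≤ 1) :
    IsUnit (scaledFeshbach tc τ hs S L ζ) := by
  rcases eq_or_ne ζ 0 with rfl | hζ0
  · have htc' : -(tc : ℂ) ≠ 0 := by simpa using htc.ne'
    have : scaledFeshbach tc τ hs S L 0 = Units.mk0 _ htc' • 1 := by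
      refine ContinuousLinearMap.ext fun v => ?_
      simp only [scaledFeshbach, sub_apply, smul_apply, one_apply_eq_self, zero_mul, zero_smul]
      change _ = (-(tc : ℂ)) • v
      simp
    rw [this]
    exact isUnit_one.smul _
  -- Covers both the lower semicircle (energies in the band) and nonzero points inside the disc with
  -- real energy (outside the band); at the latter the hypothesis rules out bound states.
  have hlow : ∀ η : ℂ, η ≠ 0 → (‖η‖ < 1 ∨ ‖η‖ = 1 ∧ η.im ≤ 0) →
      ((tc : ℂ) * (η + η⁻¹)).im = 0 → IsUnit (scaledFeshbach tc τ hs S L η) := by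
    intro η hη0 hη him
    have hE : (tc : ℂ) * (η + η⁻¹) = (((tc : ℂ) * (η + η⁻¹)).re : ℝ) :=
      Complex.ext rfl (by rw [him, Complex.ofReal_im])
    rw [feshbachMatrix_eq htc hL hη0 hη hE]
    exact (hS _).smul (Units.mk0 η hη0)
  have hcirc : ∀ η : ℂ, ‖η‖ = 1 → ((tc : ℂ) * (η + η⁻¹)).im = 0 := fun η hη => by
    rw [Complex.im_ofReal_mul, Lead.add_inv_im_eq_zero_of_norm_eq_one hη, mul_zero]
  rcases hζ.lt_or_eq with hlt | heq
  · by_cases him : ((tc : ℂ) * (ζ + ζ⁻¹)).im = 0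
    · exact hlow ζ hζ0 (Or.inl hlt) him
    · exact isUnit_scaledFeshbach_of_im_ne_zero htc.ne' h hL hζ0 hlt him
  · rcases le_total ζ.im 0 with hi | hi
    · exact hlow ζ hζ0 (Or.inr ⟨heq, hi⟩) (hcirc ζ heq)
    · rw [← Complex.conj_conj ζ, scaledFeshbach_conj h, isUnit_star]
      have heq' : ‖conj ζ‖ = 1 := by rw [Complex.norm_conj, heq]
      exact hlow _ (by simpa using hζ0) (Or.inr ⟨heq', by simpa using hi⟩) (hcirc _ heq')

end System

end

/-! ### Decay and integrability of the evolution -/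

open MeasureTheory in
/-- A continuous function on the line that decays like `|t| ^ (-3 / 2)` is integrable. -/
lemma Continuous.integrable_of_norm_le_rpow {F : ℝ → ℂ} (hc : Continuous F) {C C' : ℝ}
    (h : ∀ t : ℝ, 0 < t → ‖F t‖ ≤ C * t ^ (-(3 / 2) : ℝ))
    (h' : ∀ t : ℝ, 0 < t → ‖F (-t)‖ ≤ C' * t ^ (-(3 / 2) : ℝ)) : Integrable F := by
  have hpos : ∀ {F : ℝ → ℂ} {C : ℝ}, Continuous F →
      (∀ t : ℝ, 0 < t → ‖F t‖ ≤ C * t ^ (-(3 / 2) : ℝ)) → IntegrableOn F (Set.Ioi 0) := by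
    intro F C hc h
    -- The power `t^{-3/2}` is not integrable at `0`; continuity handles `(0, 1]`, and the bound is
    -- used only beyond `1`.
    rw [← Set.Ioc_union_Ioi_eq_Ioi (zero_le_one (α := ℝ))]
    refine hc.integrableOn_Ioc.union ?_
    refine Integrable.mono' ((integrableOn_Ioi_rpow_of_lt (a := -(3 / 2)) (by norm_num)
      one_pos).const_mul C) hc.aestronglyMeasurable ?_
    exact (ae_restrict_mem measurableSet_Ioi).mono fun t ht => h t (one_pos.trans ht)
  have hneg : IntegrableOn F (Set.Iio 0) := by
    have h2 : IntegrableOn (fun t => F (-t)) (Set.Ioi (-0)) := by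
      rw [neg_zero]
      exact hpos (hc.comp continuous_neg) h'
    simpa using h2.comp_neg_Iio
  rw [← integrableOn_univ, ← Set.Iic_union_Ioi (a := (0 : ℝ))]
  exact ((integrableOn_Iic_iff_integrableOn_Iio (by simp)).2 hneg).union (hpos hc h)

namespace System

open ComplexConjugate MeasureTheory

variable {N : ℕ} {tc τ : ℝ} {hs : Sample N →L[ℂ] Sample N} {S : Fin 2 → Sample N} {L : Fin 2 → Lead}

lemma hasSum_inner_evolution (A : System N →L[ℂ] System N) (f g : System N) (t : ℝ) :
    HasSum (fun n : ℕ => (n.factorial : ℂ)⁻¹ * (Complex.I * t) ^ n * inner ℂ f (A^[n] g))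
      (inner ℂ f (evolution A t g)) := by
  have h := NormedSpace.exp_series_hasSum_exp' (𝕂 := ℂ) ((Complex.I * (t : ℂ)) • A)
  have h2 := ((innerSL ℂ f) ∘L ContinuousLinearMap.apply ℂ (System N) g).hasSum h
  have hfun : (fun n : ℕ => (n.factorial : ℂ)⁻¹ * (Complex.I * t) ^ n * inner ℂ f (A^[n] g)) =
      fun n : ℕ => ((innerSL ℂ f) ∘L ContinuousLinearMap.apply ℂ (System N) g)
        ((n.factorial : ℂ)⁻¹ • ((Complex.I * (t : ℂ)) • A) ^ n) := funext fun n => by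
    rw [smul_pow, smul_smul, map_smul]
    change _ = _ * inner ℂ f ((A ^ n) g)
    rw [FunLike.coe_pow_eq_iterate]
  rw [hfun]
  exact h2

/-- The spectral representation of the matrix elements of the evolution. -/
lemma inner_evolution_eq (htc : 0 < tc) (h : IsSelfAdjoint hs)
    (hL : ∀ j, (L j).CompactlySupported)
    (hS : ∀ E : ℝ, IsUnit (feshbachMatrix tc τ hs S L E)) {f g : System N}
    (hf : f.CompactlySupported) (hg : g.CompactlySupported) (t : ℝ) :
    inner ℂ f (evolution (hamiltonian tc τ hs S L) t g) = Complex.I * tc / Real.pi *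
      ∫ θ in (0 : ℝ)..2 * Real.pi, Complex.exp (Complex.I * (2 * tc * t : ℝ) * Real.cos θ) *
        (Real.sin θ * resolventElement tc τ hs S L f g (circleMap 0 1 θ)) := by
  have hu : ∀ ζ : ℂ, ‖ζ‖ ≤ 1 → IsUnit (scaledFeshbach tc τ hs S L ζ) := fun ζ hζ =>
    isUnit_scaledFeshbach htc h hL hS hζ
  have hdiff : ∀ x : System N, x.CompactlySupported →
      DifferentiableOn ℂ (resolventElement tc τ hs S L f x) (Metric.closedBall 0 1) :=
    fun x hx ζ hζ => ((contDiffAt_resolventElement (n := 1) hL hf hx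
      (hu ζ (by simpa using hζ))).differentiableAt one_ne_zero).differentiableWithinAt
  have hmom := fun n => iterate_eq_integral (H := hamiltonian tc τ hs S L)
    (p := System.CompactlySupported) (fun x hx => hx.hamiltonian hL)
    (Φ := resolventElement tc τ hs S L f) (a := fun x => inner ℂ f x) (c := (tc : ℂ)) hdiff
    (fun x => resolventElement_zero f x)
    (fun x hx ζ hζ => resolventElement_hamiltonian htc.ne' hL hf hx
      (by rintro rfl; simp at hζ) (hu ζ hζ.le)) n g hg
  have hcont : Continuous fun θ : ℝ => (Real.sin θ : ℂ) *
      resolventElement tc τ hs S L f g (circleMap 0 1 θ) :=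
    Continuous.mul (by fun_prop) ((hdiff g hg).continuousOn.comp_continuous
      (continuous_circleMap 0 1) fun θ => circleMap_mem_closedBall 0 zero_le_one θ)
  have hsum := (hasSum_integral_exp_mul_cos (2 * tc * t) hcont).mul_left
    (Complex.I * tc / Real.pi)
  refine (hasSum_inner_evolution _ f g t).unique ?_
  have hfun : (fun n : ℕ => (n.factorial : ℂ)⁻¹ * (Complex.I * t) ^ n *
      inner ℂ f ((hamiltonian tc τ hs S L)^[n] g)) = fun n : ℕ => Complex.I * tc / Real.pi *
      (((n.factorial : ℂ)⁻¹ * Complex.I ^ n) * ∫ θ in (0 : ℝ)..2 * Real.pi,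
        ((2 * tc * t : ℝ) * Real.cos θ : ℂ) ^ n *
          (Real.sin θ * resolventElement tc τ hs S L f g (circleMap 0 1 θ))) := funext fun n => by
    rw [hmom n]
    have hpt : ∀ θ : ℝ, ((2 * tc * t : ℝ) * Real.cos θ : ℂ) ^ n *
          (Real.sin θ * resolventElement tc τ hs S L f g (circleMap 0 1 θ)) =
        (t : ℂ) ^ n * ((2 * tc * Real.cos θ) ^ n *
          (Real.sin θ * resolventElement tc τ hs S L f g (circleMap 0 1 θ))) := fun θ => by
      push_cast
      ring
    simp_rw [hpt]
    rw [intervalIntegral.integral_const_mul]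
    ring
  rw [hfun]
  exact hsum

lemma contDiff_resolventElement_circleMap (htc : 0 < tc) (h : IsSelfAdjoint hs)
    (hL : ∀ j, (L j).CompactlySupported)
    (hS : ∀ E : ℝ, IsUnit (feshbachMatrix tc τ hs S L E)) {f g : System N}
    (hf : f.CompactlySupported) (hg : g.CompactlySupported) {n : WithTop ℕ∞} :
    ContDiff ℝ n fun θ : ℝ => resolventElement tc τ hs S L f g (circleMap 0 1 θ) := by
  refine contDiff_iff_contDiffAt.2 fun θ => ?_
  refine ContDiffAt.comp (g := resolventElement tc τ hs S L f g) θ ?_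
    (contDiff_circleMap 0 1).contDiffAt
  exact (contDiffAt_resolventElement hL hf hg
    (isUnit_scaledFeshbach htc h hL hS (by simp))).restrict_scalars ℝ

lemma exists_norm_inner_evolution_le (htc : 0 < tc) (h : IsSelfAdjoint hs)
    (hL : ∀ j, (L j).CompactlySupported)
    (hS : ∀ E : ℝ, IsUnit (feshbachMatrix tc τ hs S L E)) {f g : System N}
    (hf : f.CompactlySupported) (hg : g.CompactlySupported) :
    ∃ C : ℝ, ∀ t : ℝ, 0 < t →
      ‖inner ℂ f (evolution (hamiltonian tc τ hs S L) t g)‖ ≤ C * t ^ (-(3 / 2) : ℝ) := by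
  obtain ⟨C, hC⟩ := exists_norm_integral_exp_mul_cos_mul_sin_le
    (contDiff_resolventElement_circleMap htc h hL hS hf hg) fun θ => by
      rw [periodic_circleMap 0 1 θ]
  -- The stationary phase bound is taken at `x = 2 tc t`, where `x √x = 2 tc √(2 tc) · t √t`; the
  -- prefactor `tc / π` is the modulus of the one in the integral representation.
  refine ⟨tc / Real.pi * (C / (2 * tc * √(2 * tc))), fun t ht => ?_⟩
  rw [inner_evolution_eq htc h hL hS hf hg, norm_mul, norm_div, norm_mul, Complex.norm_I, one_mul,
    Complex.norm_real, Complex.norm_real, Real.norm_of_nonneg htc.le,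
    Real.norm_of_nonneg Real.pi_pos.le, mul_assoc (tc / Real.pi)]
  refine mul_le_mul_of_nonneg_left ((hC (2 * tc * t) (by positivity)).trans_eq ?_) (by positivity)
  have hrpow : t ^ (-(3 / 2) : ℝ) = (t * √t)⁻¹ := by
    rw [Real.rpow_neg ht.le, show (3 / 2 : ℝ) = 1 + 1 / 2 by norm_num, Real.rpow_add ht,
      Real.rpow_one, Real.sqrt_eq_rpow]
  rw [hrpow, Real.sqrt_mul (by positivity)]
  field_simp

lemma continuous_inner_evolution (A : System N →L[ℂ] System N) (f g : System N) :
    Continuous fun t : ℝ => inner ℂ f (evolution A t g) := by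
  let := NormedAlgebra.restrictScalars ℚ ℂ (System N →L[ℂ] System N)
  have h1 : Continuous fun t : ℝ => evolution A t :=
    (NormedSpace.exp_continuous (𝔸 := System N →L[ℂ] System N)).comp (by fun_prop)
  exact continuous_const.inner (h1.clm_apply continuous_const)

/-- Reduces negative times to positive ones with `f` and `g` exchanged, so the one-sided bound
suffices for integrability on the whole line. -/
lemma inner_evolution_neg {A : System N →L[ℂ] System N} (hA : IsSelfAdjoint A) (f g : System N)
    (t : ℝ) : inner ℂ f (evolution A (-t) g) = conj (inner ℂ g (evolution A t f)) := by
  have h : evolution A (-t) = ContinuousLinearMap.adjoint (evolution A t) := by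
    rw [← ContinuousLinearMap.star_eq_adjoint, evolution, evolution, NormedSpace.star_exp,
      star_smul, hA.star_eq]
    congr 2
    simp
  rw [h, ContinuousLinearMap.adjoint_inner_right, inner_conj_symm]

lemma integrable_inner_evolution (htc : 0 < tc) (h : IsSelfAdjoint hs)
    (hL : ∀ j, (L j).CompactlySupported)
    (hS : ∀ E : ℝ, IsUnit (feshbachMatrix tc τ hs S L E)) {f g : System N}
    (hf : f.CompactlySupported) (hg : g.CompactlySupported) :
    Integrable fun t : ℝ => inner ℂ f (evolution (hamiltonian tc τ hs S L) t g) := by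
  obtain ⟨C, hC⟩ := exists_norm_inner_evolution_le htc h hL hS hf hg
  obtain ⟨C', hC'⟩ := exists_norm_inner_evolution_le htc h hL hS hg hf
  refine (continuous_inner_evolution _ f g).integrable_of_norm_le_rpow (C' := C') hC fun t ht => ?_
  rw [inner_evolution_neg (isSelfAdjoint_hamiltonian h), Complex.norm_conj]
  exact hC' t ht

end System

theorem mainTheorem6 (N : ℕ) (tc τ : ℝ) (htc : 0 < tc) (hτ : 0 < τ)
    (hs : Sample N →L[ℂ] Sample N) (hs_selfAdjoint : IsSelfAdjoint hs)
    (S : Fin 2 → Sample N) (L : Fin 2 → Lead) (hL : ∀ j, (L j).CompactlySupported)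
    (hS : ∀ E : ℝ, IsUnit (System.feshbachMatrix tc τ hs S L E)) :
    (∀ f g : System N, f.CompactlySupported → g.CompactlySupported →
      ∃ C : ℝ, ∀ t : ℝ, 1 ≤ t →
        ‖inner ℂ f (System.evolution (System.hamiltonian tc τ hs S L) t g)‖
          ≤ C * t ^ (-(3 / 2) : ℝ)) ∧
    (∀ f g : System N, f.CompactlySupported → g.CompactlySupported →
      MeasureTheory.Integrable (fun t : ℝ =>
        inner ℂ f (System.evolution (System.hamiltonian tc τ hs S L) t g))) := by
  refine ⟨fun f g hf hg => ?_, fun f g hf hg =>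
    System.integrable_inner_evolution htc hs_selfAdjoint hL hS hf hg⟩
  obtain ⟨C, hC⟩ := System.exists_norm_inner_evolution_le htc hs_selfAdjoint hL hS hf hg
  exact ⟨C, fun t ht => hC t (one_pos.trans_le ht)⟩
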